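/- Let $P$ be a convex polygon with $n\ge 3$ vertices. A triangulation $T$ of $P$ is a subdivision of $P$ into triangles by pairwise non-crossing diagonals. A 2-coloured triangulation $\{T,s\}$ is a triangulation $T$ together with a sign $s(t)\in\{+1,-1\}$ for every triangle $t$ of $T$; a signed triangulation $(T,v)$ is the class of a 2-coloured triangulation up to changing all signs simultaneously. It is recorded by its valuation $v$, which assigns to a diagonal of $T$ the value $0$ if the two triangles incident with it have the same sign, and $1$ otherwise. A 2-coloured flip replaces a diagonal whose two incident triangles have the same sign by the other diagonal of the quadrilateral formed by these two triangles, gives both new triangles the opposite sign, and keeps all other signs. Write $(T,v)\sim(T',v')$ if a (possibly empty) sequence of 2-coloured flips leads from a representative of $(T,v)$ to a representative of $(T',v')$. A vertex 4-colouring induced by $(T,v)$ is a colouring of the vertices of $P$ with four available colours such that vertices joined by a side of $P$ or a diagonal of $T$ have different colours, and such that, for any two triangles $xyz$ and $yzw$ of $T$ sharing the diagonal $yz$ (with $x\ne w$), the vertices $x$ and $w$ have the same colour if and only if $v(yz)=1$. Colourings are considered up to permutation of the four colours. Theorem. Every signed triangulation $(T,v)$ of $P$ induces exactly one vertex 4-colouring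 $\mathrm{col}(T,v)$ up to permutation of the colours. If $(T,v)\neq(T',v')$ are two distinct signed triangulations of $P$, then $(T,v)\sim(T',v')$ if and only if $\mathrm{col}(T,v)=\mathrm{col}(T',v')$ and this colouring uses all four colours. -/

import Mathlib

/-! Triangulations of a convex polygon with `n` vertices. The vertices are the elements of `Fin n`,
listed in their cyclic order along the boundary. -/

namespace PolygonFlip

/-- `e` is a boundary edge: it joins two cyclically consecutive vertices. -/
def IsSide {n : ℕ} (e : Sym2 (Fin n)) : Prop :=
  ∃ i j : Fin n, (j : ℕ) = ((i : ℕ) + 1) % n ∧ e = s(i, j)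

/-- `e` is a diagonal: it joins two distinct vertices and is not a boundary edge. -/
def IsDiagonal {n : ℕ} (e : Sym2 (Fin n)) : Prop :=
  ¬ e.IsDiag ∧ ¬ IsSide e

/-- Two segments between vertices of the convex polygon cross (meet in an interior point of both)
when their four endpoints are distinct and alternate along the boundary. -/
def Crosses {n : ℕ} (e f : Sym2 (Fin n)) : Prop :=
  ∃ a b c d : Fin n, a < b ∧ b < c ∧ c < d ∧
    ((e = s(a, c) ∧ f = s(b, d)) ∨ (e = s(b, d) ∧ f = s(a, c)))

/-- A triangulation of the convex `n`-gon: a set of pairwise non-crossing diagonals cutting the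
polygon into triangles, that is, a set of pairwise non-crossing diagonals to which no further
diagonal can be added. -/
@[ext]
structure Triangulation (n : ℕ) where
  diagonals : Finset (Sym2 (Fin n))
  isDiagonal : ∀ e ∈ diagonals, IsDiagonal e
  noncrossing : ∀ e ∈ diagonals, ∀ f ∈ diagonals, ¬ Crosses e f
  maximal : ∀ f, IsDiagonal f → (∀ e ∈ diagonals, ¬ Crosses e f) → f ∈ diagonals

/-- The edges of a triangulation: the boundary edges of the polygon and the chosen diagonals. -/
def Triangulation.IsEdge {n : ℕ} (T : Triangulation n) (e : Sym2 (Fin n)) : Prop :=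
  IsSide e ∨ e ∈ T.diagonals

/-- The triangles (faces) of a triangulation, given by their vertex sets: three vertices that are
pairwise joined by edges of the triangulation. (As all vertices lie on the boundary and edges do
not cross, nothing lies inside such a triangle.) -/
def Triangulation.IsFace {n : ℕ} (T : Triangulation n) (t : Finset (Fin n)) : Prop :=
  t.card = 3 ∧ ∀ x ∈ t, ∀ y ∈ t, x ≠ y → T.IsEdge s(x, y)

/-- A 2-coloured triangulation `{T, s}`: a triangulation with a sign `+1` or `-1` on every
triangle. -/
structure TwoColouredTriangulation (n : ℕ) where
  T : Triangulation n
  sign : {t : Finset (Fin n) // T.IsFace t} → ℤˣ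

namespace TwoColouredTriangulation

/-- Change all signs. -/
def neg {n : ℕ} (A : TwoColouredTriangulation n) : TwoColouredTriangulation n :=
  ⟨A.T, fun t => -A.sign t⟩

theorem neg_neg {n : ℕ} (A : TwoColouredTriangulation n) : A.neg.neg = A := by
  simp [neg]

/-- A 2-coloured flip from `A` to `B`: a diagonal `ac` of `A` whose two triangles `abc` and `acd`
have the same sign is replaced by the other diagonal `bd` of the quadrilateral `abcd`; the two new
triangles `abd` and `bcd` get the opposite sign, and the signs of all other triangles are kept. -/
def IsFlip {n : ℕ} (A B : TwoColouredTriangulation n) : Prop :=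
  ∃ (a b c d : Fin n)
    (habc : A.T.IsFace {a, b, c}) (hacd : A.T.IsFace {a, c, d})
    (habd : B.T.IsFace {a, b, d}) (hbcd : B.T.IsFace {b, c, d}),
    b ≠ d ∧ s(a, c) ∈ A.T.diagonals ∧
    B.T.diagonals = insert s(b, d) (A.T.diagonals.erase s(a, c)) ∧
    A.sign ⟨_, habc⟩ = A.sign ⟨_, hacd⟩ ∧
    B.sign ⟨_, habd⟩ = -A.sign ⟨_, habc⟩ ∧
    B.sign ⟨_, hbcd⟩ = -A.sign ⟨_, habc⟩ ∧
    ∀ (t : Finset (Fin n)) (hA : A.T.IsFace t) (hB : B.T.IsFace t),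
      B.sign ⟨t, hB⟩ = A.sign ⟨t, hA⟩

open Classical in
/-- The valuation of the diagonals: `0` if the two triangles incident with the diagonal have the
same sign, and `1` otherwise. -/
noncomputable def valuation {n : ℕ} (A : TwoColouredTriangulation n)
    (e : {e : Sym2 (Fin n) // e ∈ A.T.diagonals}) : Fin 2 :=
  if ∀ t u : {t : Finset (Fin n) // A.T.IsFace t},
      (∀ x ∈ e.1, x ∈ t.1) → (∀ x ∈ e.1, x ∈ u.1) → A.sign t = A.sign u
  then 0 else 1

/-- `c` is a vertex colouring obtained from `A`: it is a proper 4-colouring of the vertices of the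
triangulation, and for any two adjacent triangles `xyz` and `yzw` with common diagonal `yz`, the
vertices `x` and `w` have the same colour if and only if `yz` has value `1`. -/
def InducesColouring {n : ℕ} (A : TwoColouredTriangulation n) (c : Fin n → Fin 4) : Prop :=
  (∀ x y : Fin n, x ≠ y → A.T.IsEdge s(x, y) → c x ≠ c y) ∧
  ∀ (x y z w : Fin n) (h : s(y, z) ∈ A.T.diagonals),
    A.T.IsFace {x, y, z} → A.T.IsFace {y, z, w} → x ≠ w →
      (c x = c w ↔ A.valuation ⟨s(y, z), h⟩ = 1)

/-- Two 2-coloured triangulations are identified if they agree up to changing all signs. -/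
instance signSetoid (n : ℕ) : Setoid (TwoColouredTriangulation n) where
  r A B := B = A ∨ B = A.neg
  iseqv :=
    { refl := fun _ => Or.inl rfl
      symm := by
        rintro A B (h | h)
        · exact Or.inl h.symm
        · exact Or.inr (by rw [h, neg_neg])
      trans := by
        rintro A B C (rfl | rfl) (rfl | rfl)
        · exact Or.inl rfl
        · exact Or.inr rfl
        · exact Or.inr rfl
        · exact Or.inl (neg_neg A) }

end TwoColouredTriangulation

/-- A signed triangulation `(T, v)`: the class of a 2-coloured triangulation `{T, s}` up to
changing all signs. -/
abbrev SignedTriangulation (n : ℕ) : Type :=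
  Quotient (TwoColouredTriangulation.signSetoid n)

/-- Colourings of the vertices with four colours are identified up to a permutation of the
colours. -/
instance colourSetoid (n : ℕ) : Setoid (Fin n → Fin 4) where
  r c c' := ∃ σ : Equiv.Perm (Fin 4), c' = σ ∘ c
  iseqv :=
    { refl := fun _ => ⟨1, rfl⟩
      symm := by
        rintro c _ ⟨σ, rfl⟩
        exact ⟨σ⁻¹, by ext x; simp⟩
      trans := by
        rintro c _ _ ⟨σ, rfl⟩ ⟨τ, rfl⟩
        exact ⟨τ * σ, by ext x; simp⟩ }

/-- A vertex 4-colouring of the `n`-gon, up to permutation of the colours. -/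
abbrev VertexColouring (n : ℕ) : Type :=
  Quotient (colourSetoid n)

/-- The colouring uses all four colours. -/
def VertexColouring.UsesFourColours {n : ℕ} (κ : VertexColouring n) : Prop :=
  ∃ c : Fin n → Fin 4, κ = Quotient.mk _ c ∧ Function.Surjective c

namespace SignedTriangulation

/-- There is a (possibly empty) sequence of 2-coloured flips from `X` to `Y`. -/
def Linked {n : ℕ} (X Y : SignedTriangulation n) : Prop :=
  ∃ A B : TwoColouredTriangulation n, X = Quotient.mk _ A ∧ Y = Quotient.mk _ B ∧
    Relation.ReflTransGen TwoColouredTriangulation.IsFlip A B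

/-- `κ` is the vertex colouring `col(T, v)` induced by the signed triangulation `X = (T, v)`. -/
def Induces {n : ℕ} (X : SignedTriangulation n) (κ : VertexColouring n) : Prop :=
  ∃ (A : TwoColouredTriangulation n) (c : Fin n → Fin 4),
    X = Quotient.mk _ A ∧ κ = Quotient.mk _ c ∧ A.InducesColouring c

end SignedTriangulation

end PolygonFlip

/-! Read the colours of a properly coloured triangle in boundary order and let `sgn` turn this
triple into a sign. Two triangles on a common diagonal then have equal signs exactly when their
opposite vertices have different colours (`sgn_eq_iff`). So a colouring is induced by a signed
triangulation if and only if the signs are, up to one global sign, the orientations of the colour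
triples (`IsTri.compatible_of_locallyCompatible`). For fixed signs such a colouring exists and is
unique up to even permutations, by induction on ears: the colour of an ear's tip is determined by
its two neighbours and the sign of the ear. Odd permutations account for the global sign change.

A 2-coloured flip takes place in a quadrilateral with four different colours, and by `sgn_quad` its
sign rule says exactly that the same colouring stays compatible. Hence flips preserve the colouring,
and a single flip forces all four colours to occur.

Conversely, once a colouring is fixed, the signs can be forgotten: 2-coloured flips become flips
between properly coloured triangulations (`Step`). These are connected when four colours occur
(`conn_of_surjective`), by induction on the number of vertices. If some colour occurs only at `v`,
every triangulation can be flipped to the fan at `v`. Otherwise every colour is repeated, so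
deleting an ear's tip loses no colour, and two triangulations with a common ear are linked by
induction. In general, pick ears of the two triangulations with equal or non-adjacent tips
(`exists_nonadjacent_ears`). If the tips differ, cut off both ears and properly triangulate the rest
(`ProperCycle.exists_isTri`). With the ears glued back on, this is an intermediate triangulation
sharing an ear with each. -/

namespace PolygonFlip

variable {n : ℕ}

/-! ### Cyclic order, triangulations as maximal non-crossing graphs, and ears -/

/-- The vertices `a`, `b`, `c` are distinct and lie in this cyclic order on the boundary. -/
def Cyc (a b c : Fin n) : Prop :=
  (a < b ∧ b < c) ∨ (b < c ∧ c < a) ∨ (c < a ∧ a < b)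

/-- The segments `xy` and `zw` cross. -/
def Cr (x y z w : Fin n) : Prop :=
  (Cyc x z y ∧ Cyc y w x) ∨ (Cyc x w y ∧ Cyc y z x)

theorem Cr.comm {x y z w : Fin n} (h : Cr x y z w) : Cr z w x y := by
  grind [Cr, Cyc]

theorem Cr.swap {x y z w : Fin n} (h : Cr x y z w) : Cr y x z w := by
  grind [Cr]

/-- `G` is a triangulation, sides included, of the convex polygon with vertex set `S`. -/
structure IsTri (S : Finset (Fin n)) (G : SimpleGraph (Fin n)) : Prop where
  mem : ∀ {x y}, G.Adj x y → x ∈ S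
  noncross : ∀ {x y z w}, G.Adj x y → G.Adj z w → ¬ Cr x y z w
  maximal : ∀ {x y}, x ∈ S → y ∈ S → x ≠ y → (∀ z w, G.Adj z w → ¬ Cr x y z w) → G.Adj x y

/-- `y` is the vertex of `S` that follows `x`. -/
def Consec (S : Finset (Fin n)) (x y : Fin n) : Prop :=
  x ∈ S ∧ y ∈ S ∧ x ≠ y ∧ ∀ z ∈ S, ¬ Cyc x z y

/-- The vertex `v` is an ear of `G`, with neighbours `u` and `w` in `S`. -/
structure IsEar (S : Finset (Fin n)) (G : SimpleGraph (Fin n)) (u v w : Fin n) : Prop where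
  left : Consec S u v
  right : Consec S v w
  ne : u ≠ w
  adj : G.Adj u w

theorem exists_first (P : Fin n → Prop) {a b : Fin n} (h : ∃ x, P x ∧ Cyc a x b) :
    ∃ x, P x ∧ Cyc a x b ∧ ∀ y, P y → Cyc a y b → ¬ Cyc a y x := by
  classical
  obtain ⟨x, hx, hmin⟩ := Finset.exists_min_image
    (Finset.univ.filter fun x => P x ∧ Cyc a x b)
    -- Unrolls the cyclic order into a linear one that starts just after `a`.
    (fun x => if a < x then (x : ℕ) else x + n) (by obtain ⟨x, hx⟩ := h; exact ⟨x, by simpa⟩)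
  simp only [Finset.mem_filter, Finset.mem_univ, true_and] at hx hmin
  refine ⟨x, hx.1, hx.2, fun y h1 h2 h3 => ?_⟩
  have := hmin y ⟨h1, h2⟩
  have := x.2
  have := y.2
  grind [Cyc]

theorem exists_last (P : Fin n → Prop) {a b : Fin n} (h : ∃ x, P x ∧ Cyc a x b) :
    ∃ x, P x ∧ Cyc a x b ∧ ∀ y, P y → Cyc a y b → ¬ Cyc x y b := by
  classical
  obtain ⟨x, hx, hmax⟩ := Finset.exists_max_image
    (Finset.univ.filter fun x => P x ∧ Cyc a x b)
    (fun x => if a < x then (x : ℕ) else x + n) (by obtain ⟨x, hx⟩ := h; exact ⟨x, by simpa⟩)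
  simp only [Finset.mem_filter, Finset.mem_univ, true_and] at hx hmax
  refine ⟨x, hx.1, hx.2, fun y h1 h2 h3 => ?_⟩
  have := hmax y ⟨h1, h2⟩
  have := x.2
  have := y.2
  grind [Cyc]

theorem exists_consec_right {S : Finset (Fin n)} {x y : Fin n} (hx : x ∈ S) (hy : y ∈ S)
    (hxy : x ≠ y) : ∃ z, Consec S x z ∧ (z = y ∨ Cyc x z y) := by
  by_cases h : ∃ z, z ∈ S ∧ Cyc x z y
  · obtain ⟨z, h1, h2, h3⟩ := exists_first (· ∈ S) h
    refine ⟨z, ⟨hx, h1, by grind [Cyc], fun w hw hc => h3 w hw (by grind [Cyc]) hc⟩, .inr h2⟩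
  · push Not at h
    exact ⟨y, ⟨hx, hy, hxy, h⟩, .inl rfl⟩

theorem exists_consec_left {S : Finset (Fin n)} {x y : Fin n} (hx : x ∈ S) (hy : y ∈ S)
    (hxy : x ≠ y) : ∃ z, Consec S z y ∧ (z = x ∨ Cyc x z y) := by
  by_cases h : ∃ z, z ∈ S ∧ Cyc x z y
  · obtain ⟨z, h1, h2, h3⟩ := exists_last (· ∈ S) h
    refine ⟨z, ⟨h1, hy, by grind [Cyc], fun w hw hc => h3 w hw (by grind [Cyc]) hc⟩, .inr h2⟩
  · push Not at h
    exact ⟨x, ⟨hx, hy, hxy, h⟩, .inl rfl⟩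

theorem Consec.eq_right {S : Finset (Fin n)} {x y z : Fin n} (h : Consec S x y)
    (h' : Consec S x z) : y = z := by
  have := h.2.2.2 z h'.2.1
  have := h'.2.2.2 y h.2.1
  have := h.2.2.1
  have := h'.2.2.1
  grind [Cyc]

theorem Consec.eq_left {S : Finset (Fin n)} {x y z : Fin n} (h : Consec S x z)
    (h' : Consec S y z) : x = y := by
  have := h.2.2.2 y h'.1
  have := h'.2.2.2 x h.1
  have := h.2.2.1
  have := h'.2.2.1
  grind [Cyc]

theorem Consec.cyc {S : Finset (Fin n)} {u v w : Fin n} (h : Consec S u v) (h' : w ∈ S)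
    (hu : w ≠ u) (hv : w ≠ v) : Cyc u v w := by
  have := h.2.2.2 w h'
  have := h.2.2.1
  grind [Cyc]

section IsTri

variable {S : Finset (Fin n)} {G : SimpleGraph (Fin n)}

theorem IsTri.mem_right (h : IsTri S G) {x y : Fin n} (hxy : G.Adj x y) : y ∈ S :=
  h.mem hxy.symm

theorem IsTri.adj_of_consec (h : IsTri S G) {x y : Fin n} (hxy : Consec S x y) : G.Adj x y := by
  refine h.maximal hxy.1 hxy.2.1 hxy.2.2.1 fun z w hzw hc => ?_
  have h1 := hxy.2.2.2 z (h.mem hzw)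
  have h2 := hxy.2.2.2 w (h.mem_right hzw)
  grind [Cr]

/-- Successive neighbours of `v` span a triangle: an edge crossing `xy` would either cross `vx` or
`vy`, or end at `v` and produce a neighbour in between. -/
theorem IsTri.adj_of_neighbours (h : IsTri S G) {v x y : Fin n} (hx : G.Adj v x)
    (hy : G.Adj v y) (hxy : Cyc y v x) (hq : ∀ q, Cyc x q y → ¬ G.Adj v q) : G.Adj x y := by
  refine h.maximal (h.mem_right hx) (h.mem_right hy) (by grind [Cyc]) fun z w hzw hc => ?_
  have h1 := h.noncross hzw hx
  have h2 := h.noncross hzw hy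
  have h3 := hq z
  have h4 := hq w
  have h5 : ∀ q, q = v → G.Adj z q → G.Adj v z := fun q hq h => hq ▸ h.symm
  have h6 : ∀ q, q = v → G.Adj q w → G.Adj v w := fun q hq h => hq ▸ h
  have h7 := h5 w
  have h8 := h6 z
  clear hq h5 h6
  grind [Cyc, Cr]

theorem IsTri.exists_face (h : IsTri S G) {x y p : Fin n} (hxy : G.Adj x y) (hp : p ∈ S)
    (hc : Cyc x p y) : ∃ z, Cyc x z y ∧ G.Adj x z ∧ G.Adj z y := by
  have : ∃ z, G.Adj x z ∧ Cyc x z y := by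
    obtain ⟨z, h1, h2⟩ := exists_consec_right (h.mem hxy) hp (by grind [Cyc])
    exact ⟨z, h.adj_of_consec h1, by grind [Cyc]⟩
  -- The apex is the last neighbour of `x` before `y`, so `z` and `y` are successive neighbours of
  -- `x`.
  obtain ⟨z, h1, h2, h3⟩ := exists_last (G.Adj x) this
  refine ⟨z, h2, h1, h.adj_of_neighbours h1 hxy (by grind [Cyc]) fun q hq hxq => ?_⟩
  exact h3 q hxq (by grind [Cyc]) hq

theorem IsTri.face_unique (h : IsTri S G) {x y z w : Fin n} (hz : Cyc x z y) (hw : Cyc x w y)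
    (h1 : G.Adj x z) (h2 : G.Adj z y) (h3 : G.Adj x w) (h4 : G.Adj w y) : z = w := by
  have := h.noncross h1 h4
  have := h.noncross h2 h3
  grind [Cyc, Cr]

/-- Descend into the part cut off by `xy`: take the triangle on that side and continue beyond one of
its other two edges. When both are sides, its apex is the tip of an ear. -/
theorem IsTri.exists_isEar_between (h : IsTri S G) {x y p : Fin n} (hxy : G.Adj x y)
    (hp : p ∈ S) (hc : Cyc x p y) : ∃ u v w, IsEar S G u v w ∧ Cyc x v y := by
  classical
  induction hk : (S.filter fun q => Cyc x q y).card using Nat.strong_induction_on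
    generalizing x y p with
  | _ k ih =>
    obtain ⟨z, h1, h2, h3⟩ := h.exists_face hxy hp hc
    have hz := h.mem h3
    by_cases hl : ∃ q, q ∈ S ∧ Cyc x q z
    · obtain ⟨q, hq, hqc⟩ := hl
      obtain ⟨u, v, w, he, hv⟩ := ih _ (by
        rw [← hk]
        refine Finset.card_lt_card (Finset.ssubset_iff_of_subset ?_ |>.2 ⟨z, ?_, ?_⟩)
        · intro q; simp only [Finset.mem_filter]; grind [Cyc]
        · simp [hz, h1]
        · simp only [Finset.mem_filter]; grind [Cyc]) h2 hq hqc rfl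
      exact ⟨u, v, w, he, by grind [Cyc]⟩
    by_cases hr : ∃ q, q ∈ S ∧ Cyc z q y
    · obtain ⟨q, hq, hqc⟩ := hr
      obtain ⟨u, v, w, he, hv⟩ := ih _ (by
        rw [← hk]
        refine Finset.card_lt_card (Finset.ssubset_iff_of_subset ?_ |>.2 ⟨z, ?_, ?_⟩)
        · intro q; simp only [Finset.mem_filter]; grind [Cyc]
        · simp [hz, h1]
        · simp only [Finset.mem_filter]; grind [Cyc]) h3 hq hqc rfl
      exact ⟨u, v, w, he, by grind [Cyc]⟩
    push Not at hl hr
    exact ⟨x, z, y, ⟨⟨h.mem h2, hz, h2.ne, hl⟩, ⟨hz, h.mem_right h3, h3.ne, hr⟩, hxy.ne, hxy⟩, h1⟩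

theorem IsTri.exists_isEar (h : IsTri S G) (hS : 3 ≤ S.card) : ∃ u v w, IsEar S G u v w := by
  obtain ⟨x, y, hx, hy, hxy⟩ := Finset.one_lt_card_iff.1 (by omega : 1 < S.card)
  obtain ⟨z, hz, -⟩ := exists_consec_right hx hy hxy
  obtain ⟨p, hp, h1⟩ := Finset.exists_mem_notMem_of_card_lt_card
    (s := {x, z}) (t := S) (lt_of_le_of_lt Finset.card_le_two (by omega))
  simp only [Finset.mem_insert, Finset.mem_singleton, not_or] at h1
  obtain ⟨u, v, w, he, -⟩ := h.exists_isEar_between (h.adj_of_consec hz).symm hp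
    (by have := hz.cyc hp h1.1 h1.2; grind [Cyc])
  exact ⟨u, v, w, he⟩

theorem IsEar.cyc {u v w : Fin n} (he : IsEar S G u v w) : Cyc u v w :=
  he.left.cyc he.right.2.1 he.ne.symm he.right.2.2.1.symm

/-- A second ear is found on the far side of the edge `uw` that cuts off the first one. -/
theorem IsTri.exists_isEar_ne (h : IsTri S G) (hS : 4 ≤ S.card) {u v w : Fin n}
    (he : IsEar S G u v w) :
    ∃ u' v' w', IsEar S G u' v' w' ∧ v' ≠ u ∧ v' ≠ v ∧ v' ≠ w := by
  obtain ⟨p, hp, h1⟩ := Finset.exists_mem_notMem_of_card_lt_card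
    (s := {u, v, w}) (t := S) (lt_of_le_of_lt Finset.card_le_three (by omega))
  simp only [Finset.mem_insert, Finset.mem_singleton, not_or] at h1
  have h2 := he.left.cyc hp h1.1 h1.2.1
  have h3 := he.right.cyc hp h1.2.1 h1.2.2
  have h4 := he.cyc
  obtain ⟨u', v', w', he', h5⟩ := h.exists_isEar_between he.adj.symm hp (by grind [Cyc])
  exact ⟨u', v', w', he', by grind [Cyc]⟩

/-- Delete the vertex `v`. -/
def removeVertex (G : SimpleGraph (Fin n)) (v : Fin n) : SimpleGraph (Fin n) where
  Adj x y := G.Adj x y ∧ x ≠ v ∧ y ≠ v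
  symm := ⟨fun _ _ h => ⟨h.1.symm, h.2.2, h.2.1⟩⟩
  loopless := ⟨fun _ h => h.1.ne rfl⟩

/-- Add the vertex `v` with neighbours `u` and `w`. -/
def addVertex (G : SimpleGraph (Fin n)) (u v w : Fin n) : SimpleGraph (Fin n) :=
  G ⊔ SimpleGraph.edge u v ⊔ SimpleGraph.edge v w

theorem addVertex_adj {u v w : Fin n} (huv : u ≠ v) (hvw : v ≠ w) {x y : Fin n} :
    (addVertex G u v w).Adj x y ↔ G.Adj x y ∨ (x = u ∧ y = v) ∨ (x = v ∧ y = u) ∨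
      (x = v ∧ y = w) ∨ (x = w ∧ y = v) := by
  simp only [addVertex, SimpleGraph.sup_adj, SimpleGraph.edge_adj]
  grind

theorem IsTri.removeVertex (h : IsTri S G) {u v w : Fin n} (he : IsEar S G u v w) :
    IsTri (S.erase v) (removeVertex G v) := by
  refine ⟨fun hxy => Finset.mem_erase.2 ⟨hxy.2.1, h.mem hxy.1⟩,
    fun h1 h2 => h.noncross h1.1 h2.1, fun {x y} hx hy hxy hm => ?_⟩
  obtain ⟨hxv, hx⟩ := Finset.mem_erase.1 hx
  obtain ⟨hyv, hy⟩ := Finset.mem_erase.1 hy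
  refine ⟨h.maximal hx hy hxy fun z t hzt hc => ?_, hxv, hyv⟩
  by_cases hv : z = v ∨ t = v
  -- The edge `vt` cannot cross `uw`, so it stays inside the ear; a segment crossing it would have
  -- an endpoint strictly between `u` and `v` or between `v` and `w`.
  · have key : ∀ t, G.Adj v t → Cr x y v t → False := fun t hvt hc => by
      have h1 := hm u w ⟨he.adj, he.left.2.2.1, he.right.2.2.1.symm⟩
      have h2 := h.noncross hvt he.adj
      have h3 := he.left.2.2.2 x hx
      have h4 := he.left.2.2.2 y hy
      have h5 := he.right.2.2.2 x hx
      have h6 := he.right.2.2.2 y hy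
      have := he.cyc
      clear hm
      grind [Cyc, Cr]
    rcases hv with rfl | rfl
    · exact key t hzt hc
    · exact key z hzt.symm (by grind [Cr])
  · push Not at hv
    exact hm z t ⟨hzt, hv⟩ hc

theorem Consec.erase_mid {u v w : Fin n} (h1 : Consec S u v) (h2 : Consec S v w)
    (h3 : u ≠ w) : Consec (S.erase v) u w := by
  refine ⟨Finset.mem_erase.2 ⟨h1.2.2.1, h1.1⟩, Finset.mem_erase.2 ⟨h2.2.2.1.symm, h2.2.1⟩, h3,
    fun z hz => ?_⟩
  obtain ⟨hzv, hz⟩ := Finset.mem_erase.1 hz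
  have h4 := h1.2.2.2 z hz
  have h5 := h2.2.2.2 z hz
  grind [Cyc]

theorem consec_of_consec_erase {u v w x y : Fin n} (h1 : Consec S u v) (h2 : Consec S v w)
    (h3 : u ≠ w) (h : Consec (S.erase v) x y) : Consec S x y ∨ (x = u ∧ y = w) := by
  by_cases hv : Cyc x v y
  · have h4 := h.2.2.2 u (Finset.mem_erase.2 ⟨h1.2.2.1, h1.1⟩)
    have h5 := h.2.2.2 w (Finset.mem_erase.2 ⟨h2.2.2.1.symm, h2.2.1⟩)
    have h6 := h1.2.2.2 x (Finset.mem_erase.1 h.1).2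
    have h7 := h2.2.2.2 y (Finset.mem_erase.1 h.2.1).2
    have := h1.2.2.1
    have := h2.2.2.1
    have := h1.cyc h2.2.1 h3.symm this.symm
    right
    grind [Cyc]
  · refine .inl ⟨(Finset.mem_erase.1 h.1).2, (Finset.mem_erase.1 h.2.1).2, h.2.2.1, fun z hz => ?_⟩
    by_cases hzv : z = v
    · rwa [hzv]
    · exact h.2.2.2 z (Finset.mem_erase.2 ⟨hzv, hz⟩)

theorem IsTri.addVertex {u v w : Fin n} (h : IsTri (S.erase v) G) (h1 : Consec S u v)
    (h2 : Consec S v w) (h3 : u ≠ w) : IsTri S (addVertex G u v w) := by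
  have huw := h.adj_of_consec (Consec.erase_mid h1 h2 h3)
  have hm : ∀ {x y}, G.Adj x y → x ∈ S := fun hxy => (Finset.mem_erase.1 (h.mem hxy)).2
  have hadj {x y} := addVertex_adj (G := G) (x := x) (y := y) h1.2.2.1 h2.2.2.1
  have hcu : ∀ x ∈ S, ∀ y ∈ S, ¬ Cr x y u v := fun x hx y hy => by
    have := h1.2.2.2 x hx
    have := h1.2.2.2 y hy
    grind [Cyc, Cr]
  have hcw : ∀ x ∈ S, ∀ y ∈ S, ¬ Cr x y v w := fun x hx y hy => by
    have := h2.2.2.2 x hx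
    have := h2.2.2.2 y hy
    grind [Cyc, Cr]
  have hcyc := h1.cyc h2.2.1 h3.symm h2.2.2.1.symm
  refine ⟨fun {x y} hxy => ?_, fun {x y z t} hxy hzt hc => ?_, fun {x y} hx hy hxy hmax => ?_⟩
  · rcases hadj.1 hxy with h | ⟨rfl, -⟩ | ⟨rfl, -⟩ | ⟨rfl, -⟩ | ⟨rfl, -⟩
    exacts [hm h, h1.1, h1.2.1, h2.1, h2.2.1]
  · have hmem : ∀ {x y}, (PolygonFlip.addVertex G u v w).Adj x y → x ∈ S ∧ y ∈ S := by
      intro x y hxy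
      rcases hadj.1 hxy with h | ⟨rfl, rfl⟩ | ⟨rfl, rfl⟩ | ⟨rfl, rfl⟩ | ⟨rfl, rfl⟩
      exacts [⟨hm h, hm h.symm⟩, ⟨h1.1, h1.2.1⟩, ⟨h1.2.1, h1.1⟩, ⟨h2.1, h2.2.1⟩, ⟨h2.2.1, h2.1⟩]
    obtain ⟨hx, hy⟩ := hmem hxy
    obtain ⟨hz, ht⟩ := hmem hzt
    have hside : ∀ {x y}, (PolygonFlip.addVertex G u v w).Adj x y → G.Adj x y ∨
        ∀ z ∈ S, ∀ t ∈ S, ¬ Cr x y z t := fun {x y} hxy => by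
      rcases hadj.1 hxy with h | ⟨rfl, rfl⟩ | ⟨rfl, rfl⟩ | ⟨rfl, rfl⟩ | ⟨rfl, rfl⟩
      · exact .inl h
      · exact .inr fun z hz t ht hc => hcu z hz t ht hc.comm
      · exact .inr fun z hz t ht hc => hcu z hz t ht hc.swap.comm
      · exact .inr fun z hz t ht hc => hcw z hz t ht hc.comm
      · exact .inr fun z hz t ht hc => hcw z hz t ht hc.swap.comm
    rcases hside hxy with h1 | h1
    · rcases hside hzt with h2 | h2
      · exact h.noncross h1 h2 hc
      · exact h2 x hx y hy hc.comm
    · exact h1 z hz t ht hc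
  · rw [hadj]
    -- Maximality at `v`: every further segment from `v` is blocked by `uw`, which is already an
    -- edge because it is a side of the smaller polygon.
    have hvu : ∀ z ∈ S, z ≠ u → z ≠ w → z ≠ v → Cr v z u w := fun z hz hu hw hv => by
      have := h1.cyc hz hu hv
      have := h2.cyc hz hv hw
      grind [Cyc, Cr]
    have hnot := hmax u w (hadj.2 (.inl huw))
    by_cases hxv : x = v
    · have := hvu y hy
      grind
    by_cases hyv : y = v
    · have := hvu x hx
      grind [Cr]
    left
    exact h.maximal (Finset.mem_erase.2 ⟨hxv, hx⟩) (Finset.mem_erase.2 ⟨hyv, hy⟩) hxy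
      fun z t hzt => hmax z t (hadj.2 (.inl hzt))

theorem isEar_addVertex {u v w : Fin n} (h : IsTri (S.erase v) G) (h1 : Consec S u v)
    (h2 : Consec S v w) (h3 : u ≠ w) : IsEar S (addVertex G u v w) u v w :=
  ⟨h1, h2, h3, (addVertex_adj h1.2.2.1 h2.2.2.1).2
    (.inl (h.adj_of_consec (Consec.erase_mid h1 h2 h3)))⟩

theorem IsTri.adj_ear_iff (h : IsTri S G) {u v w : Fin n} (he : IsEar S G u v w) {z : Fin n} :
    G.Adj v z ↔ z = u ∨ z = w := by
  constructor
  · intro hz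
    by_contra! hne
    have h1 := he.left.cyc (h.mem_right hz) hne.1 hz.ne.symm
    have h2 := he.right.cyc (h.mem_right hz) hz.ne.symm hne.2
    have := h.noncross hz he.adj
    have := he.cyc
    grind [Cyc, Cr]
  · rintro (rfl | rfl)
    · exact (h.adj_of_consec he.left).symm
    · exact h.adj_of_consec he.right

theorem IsTri.addVertex_removeVertex (h : IsTri S G) {u v w : Fin n} (he : IsEar S G u v w) :
    PolygonFlip.addVertex (PolygonFlip.removeVertex G v) u v w = G := by
  ext x y
  rw [addVertex_adj he.left.2.2.1 he.right.2.2.1]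
  have h1 := h.adj_ear_iff he (z := x)
  have h2 := h.adj_ear_iff he (z := y)
  have h3 := G.adj_comm v x
  simp only [PolygonFlip.removeVertex]
  by_cases hx : x = v
  · subst hx
    have := he.left.2.2.1
    have := he.right.2.2.1
    grind
  by_cases hy : y = v
  · subst hy
    rw [G.adj_comm x y]
    grind
  grind

end IsTri

end PolygonFlip

/-! ### Flips, properly coloured flips, and fans -/

namespace PolygonFlip

variable {n : ℕ}

/-- The triangles `abc` and `acd` form a quadrilateral `abcd` in `G` with diagonal `ac`. -/
structure IsQuad (G : SimpleGraph (Fin n)) (a b c d : Fin n) : Prop where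
  cyc_left : Cyc a b c
  cyc_right : Cyc c d a
  adj₁ : G.Adj a b
  adj₂ : G.Adj b c
  adj₃ : G.Adj c d
  adj₄ : G.Adj d a
  diag : G.Adj a c

/-- Replace the edge `ac` by `bd`. -/
def flip (G : SimpleGraph (Fin n)) (a b c d : Fin n) : SimpleGraph (Fin n) :=
  G.deleteEdges {s(a, c)} ⊔ SimpleGraph.edge b d

section flip

variable {S : Finset (Fin n)} {G : SimpleGraph (Fin n)} {a b c d : Fin n}

theorem flip_adj (h : b ≠ d) {x y : Fin n} :
    (flip G a b c d).Adj x y ↔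
      (G.Adj x y ∧ ¬ (x = a ∧ y = c) ∧ ¬ (x = c ∧ y = a)) ∨
        (x = b ∧ y = d) ∨ (x = d ∧ y = b) := by
  simp only [flip, SimpleGraph.sup_adj, SimpleGraph.edge_adj, SimpleGraph.deleteEdges_adj,
    Set.mem_singleton_iff, Sym2.eq_iff]
  grind

theorem IsQuad.ne (h : IsQuad G a b c d) : b ≠ d := by
  have := h.cyc_left
  have := h.cyc_right
  grind [Cyc]

theorem cr_of_cyc {x y : Fin n} (h : Cyc a b c) (h1 : Cyc c d a) (h2 : Cyc b x d)
    (h3 : Cyc d y b) :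
    (x = c ∧ y = a) ∨ Cr a b x y ∨ Cr b c x y ∨ Cr c d x y ∨ Cr d a x y := by
  have hx : Cyc b x c ∨ x = c ∨ Cyc c x d := by grind [Cyc]
  have hy : Cyc d y a ∨ y = a ∨ Cyc a y b := by grind [Cyc]
  rcases hx with hx | hx | hx
  · exact .inr (.inr (.inl (.inl ⟨hx, by grind [Cyc]⟩)))
  · rcases hy with hy | hy | hy
    · exact .inr (.inr (.inr (.inr (.inr ⟨hy, by grind [Cyc]⟩))))
    · exact .inl ⟨hx, hy⟩
    · exact .inr (.inl (.inr ⟨hy, by grind [Cyc]⟩))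
  · exact .inr (.inr (.inr (.inl (.inl ⟨hx, by grind [Cyc]⟩))))

/-- A segment crossing a diagonal of a quadrilateral leaves through two corners or through a side.
This controls what crosses the new diagonal of a flip. -/
theorem cr_diag {x y : Fin n} (h : Cyc a b c) (h1 : Cyc c d a) (h2 : Cr b d x y) :
    (x = a ∧ y = c) ∨ (x = c ∧ y = a) ∨ Cr a b x y ∨ Cr b c x y ∨ Cr c d x y ∨ Cr d a x y := by
  rcases h2 with h2 | h2
  · exact .inr (cr_of_cyc h h1 h2.1 h2.2)
  · rcases cr_of_cyc h h1 h2.1 h2.2 with h3 | h3 | h3 | h3 | h3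
    · exact .inl ⟨h3.2, h3.1⟩
    · exact .inr (.inr (.inl h3.comm.swap.comm))
    · exact .inr (.inr (.inr (.inl h3.comm.swap.comm)))
    · exact .inr (.inr (.inr (.inr (.inl h3.comm.swap.comm))))
    · exact .inr (.inr (.inr (.inr (.inr h3.comm.swap.comm))))

theorem IsTri.flip (h : IsTri S G) (hq : IsQuad G a b c d) :
    IsTri S (PolygonFlip.flip G a b c d) := by
  have hadj {x y} := flip_adj (G := G) (a := a) (c := c) (x := x) (y := y) hq.ne
  have hdiag : ∀ {x y}, G.Adj x y → ¬ (x = a ∧ y = c) → ¬ (x = c ∧ y = a) → ¬ Cr b d x y := by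
    intro x y hxy h1 h2 hc
    have := h.noncross hq.adj₁ hxy
    have := h.noncross hq.adj₂ hxy
    have := h.noncross hq.adj₃ hxy
    have := h.noncross hq.adj₄ hxy
    have := cr_diag hq.cyc_left hq.cyc_right hc
    grind
  have hcr : Cr b d a c := by
    have := hq.cyc_left
    have := hq.cyc_right
    grind [Cr, Cyc]
  have hself : ¬ Cr b d b d := by grind [Cr, Cyc]
  refine ⟨fun {x y} hxy => ?_, fun {x y z t} hxy hzt hc => ?_, fun {x y} hx hy hxy hmax => ?_⟩
  · rcases hadj.1 hxy with ⟨h1, -⟩ | ⟨rfl, -⟩ | ⟨rfl, -⟩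
    exacts [h.mem h1, h.mem hq.adj₂, h.mem hq.adj₄]
  · rcases hadj.1 hxy with ⟨h1, h2, h3⟩ | ⟨rfl, rfl⟩ | ⟨rfl, rfl⟩ <;>
    rcases hadj.1 hzt with ⟨h1', h2', h3'⟩ | ⟨rfl, rfl⟩ | ⟨rfl, rfl⟩
    · exact h.noncross h1 h1' hc
    · exact hdiag h1 h2 h3 hc.comm
    · exact hdiag h1 h2 h3 hc.comm.swap
    · exact hdiag h1' h2' h3' hc
    · exact hself hc
    · exact hself hc.comm.swap.comm
    · exact hdiag h1' h2' h3' hc.swap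
    · exact hself hc.swap
    · exact hself hc.swap.comm.swap
  · rw [hadj]
    have hac : a ≠ c := hq.diag.ne
    have hbd := hmax b d (hadj.2 (by simp))
    -- Only `ac` has been removed. If `xy` crosses it, then `xy` must be `bd`, since it crosses no
    -- side of the quadrilateral; otherwise the maximality of `G` applies.
    by_cases hc : Cr x y a c
    · right
      have hside : ∀ z w, G.Adj z w → ¬ (z = a ∧ w = c) → ¬ (z = c ∧ w = a) → ¬ Cr z w x y :=
        fun z w hzw h1 h2 h3 => hmax z w (hadj.2 (.inl ⟨hzw, h1, h2⟩)) h3.comm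
      have h1 := hq.cyc_left
      have h2 := hq.cyc_right
      have e1 := hside _ _ hq.adj₁ (by grind [Cyc]) (by grind [Cyc])
      have e2 := hside _ _ hq.adj₂ (by grind [Cyc]) (by grind [Cyc])
      have e3 := hside _ _ hq.adj₃ (by grind [Cyc]) (by grind [Cyc])
      have e4 := hside _ _ hq.adj₄ (by grind [Cyc]) (by grind [Cyc])
      rcases cr_diag (a := b) (b := c) (c := d) (d := a) (by grind [Cyc]) (by grind [Cyc])
        (hc.comm.swap) with h | h | h | h | h | h
      exacts [.inl h, .inr h, (e2 h).elim, (e3 h).elim, (e4 h).elim, (e1 h).elim]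
    · refine .inl ⟨h.maximal hx hy hxy fun z w hzw hcr => ?_, ?_, ?_⟩
      · by_cases h1 : z = a ∧ w = c
        · exact hc (by rwa [h1.1, h1.2] at hcr)
        by_cases h2 : z = c ∧ w = a
        · rw [h2.1, h2.2] at hcr
          exact hc hcr.comm.swap.comm
        exact hmax z w (hadj.2 (.inl ⟨hzw, h1, h2⟩)) hcr
      · rintro ⟨rfl, rfl⟩
        exact hbd hcr.comm
      · rintro ⟨rfl, rfl⟩
        exact hbd hcr.comm.swap

theorem IsQuad.flip (h : IsQuad G a b c d) : IsQuad (PolygonFlip.flip G a b c d) b c d a := by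
  have h1 := h.cyc_left
  have h2 := h.cyc_right
  constructor
  · grind [Cyc]
  · grind [Cyc]
  · exact (flip_adj h.ne).2 (.inl ⟨h.adj₂, by grind [Cyc], by grind [Cyc]⟩)
  · exact (flip_adj h.ne).2 (.inl ⟨h.adj₃, by grind [Cyc], by grind [Cyc]⟩)
  · exact (flip_adj h.ne).2 (.inl ⟨h.adj₄, by grind [Cyc], by grind [Cyc]⟩)
  · exact (flip_adj h.ne).2 (.inl ⟨h.adj₁, by grind [Cyc], by grind [Cyc]⟩)
  · exact (flip_adj h.ne).2 (by simp)

theorem IsTri.flip_flip (h : IsTri S G) (hq : IsQuad G a b c d) :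
    PolygonFlip.flip (PolygonFlip.flip G a b c d) b c d a = G := by
  have hbd : ¬ G.Adj b d := fun hbd => h.noncross hbd hq.diag (by
    have := hq.cyc_left
    have := hq.cyc_right
    grind [Cr, Cyc])
  have hdb : ¬ G.Adj d b := fun h => hbd h.symm
  have hac := hq.diag
  have hca := hq.diag.symm
  have := hq.ne
  ext x y
  rw [flip_adj hq.diag.ne', flip_adj hq.ne]
  grind

end flip

/-- Adjacent vertices of `G` have different colours. -/
def Proper {κ : Type*} (col : Fin n → κ) (G : SimpleGraph (Fin n)) : Prop :=
  ∀ x y, G.Adj x y → col x ≠ col y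

/-- A flip of a triangulation of `S` whose new edge joins vertices of different colours. -/
def Step {κ : Type*} (col : Fin n → κ) (S : Finset (Fin n)) (G H : SimpleGraph (Fin n)) : Prop :=
  IsTri S G ∧ Proper col G ∧
    ∃ a b c d, IsQuad G a b c d ∧ col b ≠ col d ∧ H = flip G a b c d

section Step

variable {κ : Type*} {col : Fin n → κ} {S : Finset (Fin n)} {G H : SimpleGraph (Fin n)}

theorem Proper.flip (h : Proper col G) {a b c d : Fin n} (hq : IsQuad G a b c d)
    (hbd : col b ≠ col d) : Proper col (PolygonFlip.flip G a b c d) := by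
  intro x y hxy
  rcases (flip_adj hq.ne).1 hxy with h1 | ⟨rfl, rfl⟩ | ⟨rfl, rfl⟩
  exacts [h x y h1.1, hbd, hbd.symm]

theorem Step.isTri (h : Step col S G H) : IsTri S H := by
  obtain ⟨h1, -, a, b, c, d, h2, -, rfl⟩ := h
  exact h1.flip h2

theorem Step.proper (h : Step col S G H) : Proper col H := by
  obtain ⟨-, h1, a, b, c, d, h2, h3, rfl⟩ := h
  exact h1.flip h2 h3

theorem Step.symm (h : Step col S G H) : Step col S H G := by
  refine ⟨h.isTri, h.proper, ?_⟩
  obtain ⟨h1, h0, a, b, c, d, h2, -, rfl⟩ := h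
  -- The flip back restores `ac`, whose ends differ in colour because `G` was proper.
  exact ⟨b, c, d, a, h2.flip, (h0 _ _ h2.diag).symm, (h1.flip_flip h2).symm⟩

theorem Step.reflTransGen_symm (h : Relation.ReflTransGen (Step col S) G H) :
    Relation.ReflTransGen (Step col S) H G := by
  induction h with
  | refl => exact .refl
  | tail _ h ih => exact .head h.symm ih

theorem Proper.addVertex (h : Proper col G) {u v w : Fin n} (huv : u ≠ v) (hvw : v ≠ w)
    (h1 : col u ≠ col v) (h2 : col v ≠ col w) : Proper col (addVertex G u v w) := by
  intro x y hxy
  rcases (addVertex_adj huv hvw).1 hxy with h3 | ⟨rfl, rfl⟩ | ⟨rfl, rfl⟩ | ⟨rfl, rfl⟩ | ⟨rfl, rfl⟩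
  exacts [h _ _ h3, h1, h1.symm, h2, h2.symm]

theorem Proper.removeVertex (h : Proper col G) (v : Fin n) : Proper col (removeVertex G v) :=
  fun x y hxy => h x y hxy.1

theorem Step.addVertex {u v w : Fin n} (h : Step col (S.erase v) G H) (h1 : Consec S u v)
    (h2 : Consec S v w) (h3 : u ≠ w) (h4 : col u ≠ col v) (h5 : col v ≠ col w) :
    Step col S (addVertex G u v w) (PolygonFlip.addVertex H u v w) := by
  obtain ⟨hG, hp, a, b, c, d, hq, hbd, rfl⟩ := h
  have hadj {G x y} := addVertex_adj (G := G) (x := x) (y := y) h1.2.2.1 h2.2.2.1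
  refine ⟨hG.addVertex h1 h2 h3, hp.addVertex h1.2.2.1 h2.2.2.1 h4 h5, a, b, c, d,
    ⟨hq.cyc_left, hq.cyc_right, hadj.2 (.inl hq.adj₁), hadj.2 (.inl hq.adj₂),
      hadj.2 (.inl hq.adj₃), hadj.2 (.inl hq.adj₄), hadj.2 (.inl hq.diag)⟩, hbd, ?_⟩
  have ha : a ≠ v := (Finset.mem_erase.1 (hG.mem hq.adj₁)).1
  have hc : c ≠ v := (Finset.mem_erase.1 (hG.mem hq.adj₃)).1
  ext x y
  rw [hadj, flip_adj hq.ne, flip_adj hq.ne, hadj]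
  grind

end Step

/-- Every triangulation is determined by a vertex that is joined to all others. -/
theorem IsTri.eq_of_universal {S : Finset (Fin n)} {G H : SimpleGraph (Fin n)} (hG : IsTri S G)
    (hH : IsTri S H) {v : Fin n} (h1 : ∀ x ∈ S, x ≠ v → G.Adj v x)
    (h2 : ∀ x ∈ S, x ≠ v → H.Adj v x) : G = H := by
  have key : ∀ {G H : SimpleGraph (Fin n)}, IsTri S G → IsTri S H →
      (∀ x ∈ S, x ≠ v → G.Adj v x) → (∀ x ∈ S, x ≠ v → H.Adj v x) →
      ∀ {x y}, G.Adj x y → H.Adj x y := by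
    intro G H hG hH h1 h2 x y hxy
    by_cases hx : x = v
    · subst hx
      exact h2 y (hG.mem_right hxy) hxy.ne'
    by_cases hy : y = v
    · subst hy
      exact (h2 x (hG.mem hxy) hxy.ne).symm
    refine hH.maximal (hG.mem hxy) (hG.mem_right hxy) hxy.ne fun z w hzw hc => ?_
    -- If `zw` crosses `xy`, one of `z`, `w` is separated from `v` by `xy`, so the spoke from `v` to
    -- it crosses `xy` as well.
    have h3 : ∀ q ∈ S, ¬ Cr x y v q := fun q hq hc =>
      hG.noncross hxy (h1 q hq (by rintro rfl; grind [Cr, Cyc])) hc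
    have h4 := h3 z (hH.mem hzw)
    have h5 := h3 w (hH.mem_right hzw)
    grind [Cr, Cyc]
  ext x y
  exact ⟨key hG hH h1 h2, key hH hG h2 h1⟩

/-- The last neighbour `x` before `p` and the first neighbour `y` after `p` are joined by an edge
that hides `p` from `v`; flipping it gives `v` a new neighbour. -/
theorem IsTri.exists_quad_of_not_universal {S : Finset (Fin n)} {G : SimpleGraph (Fin n)}
    (hG : IsTri S G) {v p : Fin n} (hv : v ∈ S) (hp : p ∈ S) (hpv : p ≠ v) (hadj : ¬ G.Adj v p) :
    ∃ x z y, IsQuad G x z y v := by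
  obtain ⟨x₀, h1, h2⟩ := exists_consec_right hv hp hpv.symm
  obtain ⟨y₀, h3, h4⟩ := exists_consec_left hp hv hpv
  have h5 := hG.adj_of_consec h1
  have h6 := (hG.adj_of_consec h3).symm
  obtain ⟨x, hx, hx1, hx2⟩ := exists_last (G.Adj v) (a := v) (b := p)
    ⟨x₀, h5, h2.resolve_left fun h => hadj (h ▸ h5)⟩
  obtain ⟨y, hy, hy1, hy2⟩ := exists_first (G.Adj v) (a := p) (b := v)
    ⟨y₀, h6, h4.resolve_left fun h => hadj (h ▸ h6)⟩
  have hxy : G.Adj x y := hG.adj_of_neighbours hx hy (by grind [Cyc]) fun q hq hvq => by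
    have := hx2 q hvq
    have := hy2 q hvq
    have : q ≠ p := by rintro rfl; exact hadj hvq
    grind [Cyc]
  obtain ⟨z, hz, hxz, hzy⟩ := hG.exists_face hxy hp (by grind [Cyc])
  exact ⟨x, z, y, hz, by grind [Cyc], hxz, hzy, hy.symm, hx, hxy⟩

/-- Each flip of an edge hiding a vertex from `v` adds one neighbour and loses none. It is always
allowed, because no other vertex has the colour of `v`. -/
theorem exists_universal {κ : Type*} {col : Fin n → κ} {S : Finset (Fin n)}
    {G : SimpleGraph (Fin n)} (hG : IsTri S G) (hp : Proper col G) {v : Fin n} (hv : v ∈ S)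
    (huniq : ∀ x ∈ S, col x = col v → x = v) :
    ∃ H, Relation.ReflTransGen (Step col S) G H ∧ IsTri S H ∧
      ∀ x ∈ S, x ≠ v → H.Adj v x := by
  classical
  induction hk : (S.filter fun x => ¬ G.Adj v x).card using Nat.strong_induction_on
    generalizing G with
  | _ k ih =>
    by_cases hall : ∀ x ∈ S, x ≠ v → G.Adj v x
    · exact ⟨G, .refl, hG, hall⟩
    push Not at hall
    obtain ⟨p, hpS, hpv, hadj⟩ := hall
    obtain ⟨x, z, y, hq⟩ := hG.exists_quad_of_not_universal hv hpS hpv hadj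
    have hzv : ¬ G.Adj v z := fun h => hG.noncross h hq.diag (by
      have := hq.cyc_left
      have := hq.cyc_right
      grind [Cr, Cyc])
    have hcol : col z ≠ col v := fun h => hq.ne (huniq z (hG.mem hq.adj₂) h)
    have h1 := hq.cyc_left
    have h2 := hq.cyc_right
    obtain ⟨H, h3, h4⟩ := ih _ (by
      rw [← hk]
      refine Finset.card_lt_card (Finset.ssubset_iff_of_subset ?_ |>.2 ⟨z, ?_, ?_⟩)
      · intro q
        simp only [Finset.mem_filter, flip_adj hq.ne]
        grind [Cyc]
      · simp [hG.mem hq.adj₂, hzv]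
      · simp [flip_adj hq.ne]) (hG.flip hq) (hp.flip hq hcol) rfl
    exact ⟨H, .head ⟨hG, hp, x, z, y, v, hq, hcol, rfl⟩ h3, h4⟩

theorem conn_of_unique_colour {κ : Type*} {col : Fin n → κ} {S : Finset (Fin n)}
    {G H : SimpleGraph (Fin n)} (hG : IsTri S G) (hH : IsTri S H) (hpG : Proper col G)
    (hpH : Proper col H) {v : Fin n} (hv : v ∈ S) (huniq : ∀ x ∈ S, col x = col v → x = v) :
    Relation.ReflTransGen (Step col S) G H := by
  obtain ⟨G', h1, h2, h3⟩ := exists_universal hG hpG hv huniq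
  obtain ⟨H', h4, h5, h6⟩ := exists_universal hH hpH hv huniq
  obtain rfl := h2.eq_of_universal h5 h3 h6
  exact h1.trans (Step.reflTransGen_symm h4)

end PolygonFlip

/-! ### Properly coloured polygons and their triangulations -/

namespace PolygonFlip

variable {n : ℕ}

section colours

variable {κ : Type*} {col : Fin n → κ} {S : Finset (Fin n)} {G H : SimpleGraph (Fin n)}

/-- Consecutive vertices of `S` have different colours. -/
def ProperCycle (col : Fin n → κ) (S : Finset (Fin n)) : Prop :=
  ∀ x y, Consec S x y → col x ≠ col y

theorem Proper.properCycle (h : Proper col G) (hG : IsTri S G) : ProperCycle col S :=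
  fun x y hxy => h x y (hG.adj_of_consec hxy)

theorem ProperCycle.erase (h : ProperCycle col S) {u v w : Fin n} (h1 : Consec S u v)
    (h2 : Consec S v w) (h3 : col u ≠ col w) : ProperCycle col (S.erase v) := by
  intro x y hxy
  rcases consec_of_consec_erase h1 h2 (fun h => h3 (h ▸ rfl)) hxy with h4 | ⟨rfl, rfl⟩
  exacts [h x y h4, h3]

theorem Consec.erase {x y v : Fin n} (h : Consec S x y) (hx : x ≠ v) (hy : y ≠ v) :
    Consec (S.erase v) x y :=
  ⟨Finset.mem_erase.2 ⟨hx, h.1⟩, Finset.mem_erase.2 ⟨hy, h.2.1⟩, h.2.2.1,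
    fun z hz => h.2.2.2 z (Finset.mem_erase.1 hz).2⟩

theorem exists_consec_ne (hS : 3 ≤ S.card) {u v : Fin n} (h : Consec S u v) :
    ∃ w, Consec S v w ∧ w ≠ u := by
  obtain ⟨p, hp, h1⟩ := Finset.exists_mem_notMem_of_card_lt_card
    (s := {u, v}) (t := S) (lt_of_le_of_lt Finset.card_le_two (by omega))
  simp only [Finset.mem_insert, Finset.mem_singleton, not_or] at h1
  have h2 := h.cyc hp h1.1 h1.2
  obtain ⟨w, hw, hc⟩ := exists_consec_right h.2.1 hp (Ne.symm h1.2)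
  exact ⟨w, hw, by grind [Cyc]⟩

theorem exists_consec (hS : 2 ≤ S.card) {x : Fin n} (hx : x ∈ S) :
    ∃ y, Consec S x y := by
  obtain ⟨p, hp, h1⟩ := Finset.exists_mem_ne (by omega : 1 < S.card) x
  obtain ⟨w, hw, -⟩ := exists_consec_right hx hp h1.symm
  exact ⟨w, hw⟩

variable [DecidableEq κ]

/-- If vertices at distance two always had equal colours, two colours would alternate. The
contradiction comes at the first third-coloured vertex, compared with the vertex two places earlier.
-/
theorem exists_consec_consec_ne (h : 3 ≤ (S.image col).card) :
    ∃ u v w, Consec S u v ∧ Consec S v w ∧ col u ≠ col w := by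
  by_contra! hall
  have hS : 3 ≤ S.card := h.trans Finset.card_image_le
  obtain ⟨v₀, hv₀⟩ := Finset.card_pos.1 (by omega : 0 < S.card)
  obtain ⟨v₁, hv₁⟩ := exists_consec (by omega) hv₀
  suffices S.image col ⊆ {col v₀, col v₁} by
    have := (Finset.card_le_card this).trans Finset.card_le_two
    omega
  rw [Finset.image_subset_iff]
  simp only [Finset.mem_insert, Finset.mem_singleton]
  by_contra! hex
  obtain ⟨x₀, hx₀, hx₁, hx₂⟩ := hex
  obtain ⟨x, ⟨hx, hxa, hxb⟩, hc, hmin⟩ := exists_first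
    (fun x => x ∈ S ∧ col x ≠ col v₀ ∧ col x ≠ col v₁) (a := v₁) (b := v₀)
    ⟨x₀, ⟨hx₀, hx₁, hx₂⟩, by
      have := hv₁.cyc hx₀ (fun h => hx₁ (h ▸ rfl)) (fun h => hx₂ (h ▸ rfl))
      grind [Cyc]⟩
  have hmin' : ∀ y ∈ S, Cyc v₁ y x → col y = col v₀ ∨ col y = col v₁ := fun y hy hyx => by
    by_contra! hne
    exact hmin y ⟨hy, hne⟩ (by grind [Cyc]) hyx
  obtain ⟨p, hp, hp'⟩ := exists_consec_left hv₁.2.1 hx (fun h => hxb (h ▸ rfl))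
  rcases hp' with rfl | hp'
  · exact hxa (hall _ _ _ hv₁ hp).symm
  obtain ⟨q, hq, hq'⟩ := exists_consec_left hv₁.2.1 hp.1 (by grind [Cyc])
  have := hall _ _ _ hq hp
  rcases hq' with rfl | hq'
  · exact hxb this.symm
  · have := hmin' q hq.1 (by grind [Cyc])
    grind

theorem ProperCycle.exists_removable (h : ProperCycle col S) (hS : 4 ≤ S.card)
    (h3 : 3 ≤ (S.image col).card) :
    ∃ u v w, Consec S u v ∧ Consec S v w ∧ col u ≠ col w ∧ 3 ≤ ((S.erase v).image col).card := by
  -- If a colour occurs only at `v₀`, delete the successor `v` of `v₀`: then `v₀` and the next two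
  -- vertices `w`, `t` still show three colours. If every colour is repeated, no deletion loses a
  -- colour.
  by_cases huniq : ∃ v₀ ∈ S, ∀ x ∈ S, col x = col v₀ → x = v₀
  · obtain ⟨v₀, hv₀, huniq⟩ := huniq
    obtain ⟨v, hv⟩ := exists_consec (by omega) hv₀
    obtain ⟨w, hw, hw₀⟩ := exists_consec_ne (by omega) hv
    obtain ⟨p, hp, h1⟩ := Finset.exists_mem_notMem_of_card_lt_card
      (s := {v₀, v, w}) (t := S) (lt_of_le_of_lt Finset.card_le_three (by omega))
    simp only [Finset.mem_insert, Finset.mem_singleton, not_or] at h1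
    obtain ⟨t, ht, htp⟩ := exists_consec_right hw.2.1 hp (Ne.symm h1.2.2)
    have hwv := hw.2.2.1
    have e1 := hv.cyc hp h1.1 h1.2.1
    have e2 := hw.cyc hp h1.2.1 h1.2.2
    have e3 := hv.cyc hw.2.1 hw₀ hwv.symm
    have htv : t ≠ v₀ ∧ t ≠ v := by
      grind [Cyc]
    refine ⟨v₀, v, w, hv, hw, fun h => hw₀ (huniq w hw.2.1 h.symm), ?_⟩
    have : ({col v₀, col w, col t} : Finset κ) ⊆ (S.erase v).image col := by
      have hm : ∀ x ∈ S, x ≠ v → col x ∈ (S.erase v).image col := fun x hx hxv =>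
        Finset.mem_image_of_mem _ (Finset.mem_erase.2 ⟨hxv, hx⟩)
      simp only [Finset.insert_subset_iff, Finset.singleton_subset_iff]
      exact ⟨hm _ hv₀ hv.2.2.1, hm _ hw.2.1 hwv.symm, hm _ ht.2.1 htv.2⟩
    refine le_trans (Finset.card_eq_three.2 ⟨_, _, _, ?_, ?_, ?_, rfl⟩).ge
      (Finset.card_le_card this)
    · exact fun h => hw₀ (huniq w hw.2.1 h.symm)
    · exact fun h => htv.1 (huniq t ht.2.1 h.symm)
    · exact h _ _ ht
  · push Not at huniq
    obtain ⟨u, v, w, hu, hw, huw⟩ := exists_consec_consec_ne h3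
    refine ⟨u, v, w, hu, hw, huw, h3.trans (Finset.card_le_card ?_)⟩
    intro k hk
    obtain ⟨x, hx, rfl⟩ := Finset.mem_image.1 hk
    by_cases hxv : x = v
    · subst hxv
      obtain ⟨y, hy, hy1, hy2⟩ := huniq x hx
      exact Finset.mem_image.2 ⟨y, Finset.mem_erase.2 ⟨hy2, hy⟩, hy1⟩
    · exact Finset.mem_image_of_mem _ (Finset.mem_erase.2 ⟨hxv, hx⟩)

theorem isTri_of_card_le_three (hS : S.card ≤ 3) :
    IsTri S (SimpleGraph.fromRel fun x y => x ∈ S ∧ y ∈ S) := by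
  have hadj : ∀ {x y}, (SimpleGraph.fromRel fun x y => x ∈ S ∧ y ∈ S).Adj x y ↔
      x ≠ y ∧ x ∈ S ∧ y ∈ S := by
    intro x y
    rw [SimpleGraph.fromRel_adj]
    tauto
  refine ⟨fun hxy => (hadj.1 hxy).2.1, fun {x y z w} hxy hzw hc => ?_,
    fun hx hy hxy _ => hadj.2 ⟨hxy, hx, hy⟩⟩
  rw [hadj] at hxy hzw
  have : ({x, y, z, w} : Finset (Fin n)).card = 4 := by
    have : x ≠ z ∧ x ≠ w ∧ y ≠ z ∧ y ≠ w ∧ z ≠ w := by grind [Cr, Cyc]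
    rw [Finset.card_insert_of_notMem, Finset.card_insert_of_notMem, Finset.card_pair] <;> simp <;>
      tauto
  have : ({x, y, z, w} : Finset (Fin n)) ⊆ S := by
    simp only [Finset.insert_subset_iff, Finset.singleton_subset_iff]
    tauto
  have := Finset.card_le_card this
  omega

/-- Repeatedly cut off an ear between two differently coloured neighbours while keeping three
colours. The process ends at a triangle with three different colours. -/
theorem ProperCycle.exists_isTri (h : ProperCycle col S) (h3 : 3 ≤ (S.image col).card) :
    ∃ G, IsTri S G ∧ Proper col G := by
  induction hk : S.card generalizing S with
  | zero => simp_all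
  | succ k ih =>
    by_cases hk4 : 4 ≤ S.card
    · obtain ⟨u, v, w, hu, hw, huw, hv⟩ := h.exists_removable hk4 h3
      obtain ⟨G, hG, hp⟩ := ih (h.erase hu hw huw) hv
        (by rw [Finset.card_erase_of_mem hu.2.1]; omega)
      exact ⟨_, hG.addVertex hu hw fun h => huw (h ▸ rfl),
        hp.addVertex hu.2.2.1 hw.2.2.1 (h _ _ hu) (h _ _ hw)⟩
    · refine ⟨_, isTri_of_card_le_three (by omega), fun x y hxy hc => ?_⟩
      have hinj : Set.InjOn col S := Finset.card_image_iff.1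
        (le_antisymm Finset.card_image_le (by omega))
      rw [SimpleGraph.fromRel_adj] at hxy
      exact hxy.1 (hinj (by simp only [Finset.mem_coe]; tauto)
        (by simp only [Finset.mem_coe]; tauto) hc)

end colours

/-! ### Connectedness under properly coloured flips -/

section ears

variable {S : Finset (Fin n)} {G H : SimpleGraph (Fin n)}

/-- Each triangulation has two ears. If both tips of one were distinct from and adjacent to both
tips of the other, the four tips would form the whole boundary cycle, leaving no room for a fifth
vertex `p`. -/
theorem exists_nonadjacent_ears (hG : IsTri S G) (hH : IsTri S H) (hS : 5 ≤ S.card) :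
    ∃ u v w u' v' w', IsEar S G u v w ∧ IsEar S H u' v' w' ∧
      (v = v' ∨ (v ≠ v' ∧ ¬ Consec S v v' ∧ ¬ Consec S v' v)) := by
  obtain ⟨u₁, v₁, w₁, e₁⟩ := hG.exists_isEar (by omega)
  obtain ⟨u₂, v₂, w₂, e₂, -, hv, -⟩ := hG.exists_isEar_ne (by omega) e₁
  obtain ⟨a₁, b₁, c₁, f₁⟩ := hH.exists_isEar (by omega)
  obtain ⟨a₂, b₂, c₂, f₂, -, hb, -⟩ := hH.exists_isEar_ne (by omega) f₁
  by_contra! hall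
  have key : ∀ {u v w u' v' w'}, IsEar S G u v w → IsEar S H u' v' w' →
      v ≠ v' ∧ (Consec S v v' ∨ Consec S v' v) := fun e f => by
    have := hall _ _ _ _ _ _ e f
    tauto
  obtain ⟨p, hp, h1⟩ := Finset.exists_mem_notMem_of_card_lt_card
    (s := {v₁, v₂, b₁, b₂}) (t := S) (lt_of_le_of_lt Finset.card_le_four (by omega))
  simp only [Finset.mem_insert, Finset.mem_singleton, not_or] at h1
  obtain ⟨p1, p2, p3, p4⟩ := h1
  obtain ⟨n11, k11⟩ := key e₁ f₁
  obtain ⟨n12, k12⟩ := key e₁ f₂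
  obtain ⟨n21, k21⟩ := key e₂ f₁
  obtain ⟨n22, k22⟩ := key e₂ f₂
  have hcon : ∀ {x y}, Consec S x y → p ≠ x → p ≠ y → Cyc x y p ∧ ¬ Cyc x v₁ y ∧ ¬ Cyc x v₂ y ∧
      ¬ Cyc x b₁ y ∧ ¬ Cyc x b₂ y := fun h hx hy =>
    ⟨h.cyc hp hx hy, h.2.2.2 _ e₁.left.2.1, h.2.2.2 _ e₂.left.2.1, h.2.2.2 _ f₁.left.2.1,
      h.2.2.2 _ f₂.left.2.1⟩
  replace k11 := k11.imp (fun h => hcon h p1 p3) (fun h => hcon h p3 p1)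
  replace k12 := k12.imp (fun h => hcon h p1 p4) (fun h => hcon h p4 p1)
  replace k21 := k21.imp (fun h => hcon h p2 p3) (fun h => hcon h p3 p2)
  replace k22 := k22.imp (fun h => hcon h p2 p4) (fun h => hcon h p4 p2)
  clear hcon key hall e₁ e₂ f₁ f₂ hG hH hp hS
  rcases k11 with k11 | k11 <;> rcases k12 with k12 | k12 <;> rcases k21 with k21 | k21 <;>
    rcases k22 with k22 | k22 <;> grind (splits := 20) [Cyc]

variable {col : Fin n → Fin 4}

/-- Two properly coloured triangulations are linked by flips if all four colours occur. -/
theorem conn_of_surjective (hG : IsTri S G) (hH : IsTri S H) (hpG : Proper col G)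
    (hpH : Proper col H) (hcol : ∀ k, ∃ x ∈ S, col x = k) :
    Relation.ReflTransGen (Step col S) G H := by
  induction hk : S.card generalizing S G H with
  | zero =>
    obtain ⟨x, hx, -⟩ := hcol 0
    simp_all
  | succ k ih =>
    by_cases huniq : ∃ v ∈ S, ∀ x ∈ S, col x = col v → x = v
    · obtain ⟨v, hv, huniq⟩ := huniq
      exact conn_of_unique_colour hG hH hpG hpH hv huniq
    push Not at huniq
    have himg : S.image col = Finset.univ := by
      ext x
      simpa using hcol x
    have h4 : 4 ≤ S.card := by
      have := Finset.card_image_le (s := S) (f := col)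
      rw [himg] at this
      simpa using this
    -- With four vertices and four colours the colouring is injective, so no colour is repeated.
    have h5 : 5 ≤ S.card := by
      by_contra h5
      have hinj : Set.InjOn col S := Finset.card_image_iff.1 (by
        rw [himg, Finset.card_univ, Fintype.card_fin]; omega)
      obtain ⟨x, hx, -⟩ := hcol 0
      obtain ⟨y, hy, hyx, hne⟩ := huniq x hx
      exact hne (hinj hy hx hyx)
    -- A common ear is deleted, the induction hypothesis is applied, and the ear is glued back onto
    -- every triangulation along the path.
    have common : ∀ {G H : SimpleGraph (Fin n)}, IsTri S G → IsTri S H → Proper col G →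
        Proper col H → ∀ {u v w}, IsEar S G u v w → IsEar S H u v w →
        Relation.ReflTransGen (Step col S) G H := by
      intro G H hG hH hpG hpH u v w e f
      have h := ih (hG.removeVertex e) (hH.removeVertex f) (hpG.removeVertex v)
        (hpH.removeVertex v) (fun k => by
          obtain ⟨x, hx, rfl⟩ := hcol k
          by_cases hxv : x = v
          · subst hxv
            obtain ⟨y, hy, hyx, hne⟩ := huniq x hx
            exact ⟨y, Finset.mem_erase.2 ⟨hne, hy⟩, hyx⟩
          · exact ⟨x, Finset.mem_erase.2 ⟨hxv, hx⟩, rfl⟩)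
        (by rw [Finset.card_erase_of_mem e.left.2.1]; omega)
      have h' : Relation.ReflTransGen (Step col S) (addVertex (removeVertex G v) u v w)
          (addVertex (removeVertex H v) u v w) := h.lift (fun G => addVertex G u v w) fun _ _ h =>
        h.addVertex e.left e.right e.ne (hpG _ _ (hG.adj_of_consec e.left))
          (hpG _ _ (hG.adj_of_consec e.right))
      rwa [hG.addVertex_removeVertex e, hH.addVertex_removeVertex f] at h'
    obtain ⟨u, v, w, u', v', w', e, f, hvv⟩ := exists_nonadjacent_ears hG hH h5
    rcases hvv with rfl | ⟨hne, hc, hc'⟩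
    · obtain rfl := e.left.eq_left f.left
      obtain rfl := e.right.eq_right f.right
      exact common hG hH hpG hpH e f
    have hu'v : u' ≠ v := fun h => hc (h ▸ f.left)
    have hw'v : w' ≠ v := fun h => hc' (h ▸ f.right)
    have f1 := f.left.erase hu'v hne.symm
    have f2 := f.right.erase hne.symm hw'v
    have hcyc := hpG.properCycle hG
    have huv := hcyc _ _ e.left
    have hvw := hcyc _ _ e.right
    have huw := hpG _ _ e.adj
    have hu'v' := hcyc _ _ f.left
    have hv'w' := hcyc _ _ f.right
    have hu'w' := hpH _ _ f.adj
    -- Deleting both tips can lose at most the colour of `v`: any other colour is repeated, so it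
    -- survives the loss of `v'`. Three colours therefore remain.
    obtain ⟨T, hT, hpT⟩ := ((hcyc.erase e.left e.right huw).erase f1 f2 hu'w').exists_isTri (by
      have : Finset.univ.erase (col v) ⊆ ((S.erase v).erase v').image col := by
        intro k hk
        obtain ⟨x, hx, rfl⟩ := hcol k
        have hxv : col x ≠ col v := (Finset.mem_erase.1 hk).1
        have hm : ∀ y ∈ S, y ≠ v' → col y = col x → col x ∈ ((S.erase v).erase v').image col :=
          fun y hy hy1 hy2 => Finset.mem_image.2 ⟨y, Finset.mem_erase.2 ⟨hy1,
            Finset.mem_erase.2 ⟨fun h => hxv (hy2 ▸ h ▸ rfl), hy⟩⟩, hy2⟩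
        by_cases hxv' : x = v'
        · obtain ⟨y, hy, hyx, hne'⟩ := huniq x hx
          exact hm y hy (hxv' ▸ hne') hyx
        · exact hm x hx hxv' rfl
      have := Finset.card_le_card this
      rwa [Finset.card_erase_of_mem (Finset.mem_univ _), Finset.card_univ, Fintype.card_fin]
        at this)
    have hT1 := hT.addVertex f1 f2 f.ne
    have hpT1 := hpT.addVertex f.left.2.2.1 f.right.2.2.1 hu'v' hv'w'
    have hT2 := hT1.addVertex e.left e.right e.ne
    have hpT2 := hpT1.addVertex e.left.2.2.1 e.right.2.2.1 huv hvw
    have e' := isEar_addVertex hT1 e.left e.right e.ne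
    have f' : IsEar S (addVertex (addVertex T u' v' w') u v w) u' v' w' :=
      ⟨f.left, f.right, f.ne, (addVertex_adj e.left.2.2.1 e.right.2.2.1).2
        (.inl (isEar_addVertex hT f1 f2 f.ne).adj)⟩
    exact (common hG hT2 hpG hpT2 e e').trans (common hT2 hH hpT2 hpH f' f)

end ears

end PolygonFlip

/-! ### Orientation of colour triples: from signs to colourings -/

namespace PolygonFlip

variable {n : ℕ}

/-- The sign of the permutation of the four colours with values `a`, `b`, `c` at `0`, `1`, `2`. -/
def sgn (a b c : Fin 4) : ℤˣ :=
  -- The fourth value is `d = 6 - a - b - c`. It is smaller than `3 - d` of the others, and `3 - d`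
  -- has the parity of `a + b + c + 1`.
  if ((if b < a then 1 else 0) + (if c < b then 1 else 0) + (if c < a then 1 else 0) +
    (a : ℕ) + b + c + 1) % 2 = 0 then 1 else -1

theorem sgn_rotate : ∀ a b c, a ≠ b → b ≠ c → c ≠ a → sgn b c a = sgn a b c := by decide

/-- The triples `abc` and `cbd` traverse the shared edge in opposite directions, as neighbouring
triangles do. This is the link between valuation and colours. -/
theorem sgn_eq_iff : ∀ a b c d, a ≠ b → b ≠ c → c ≠ a → b ≠ d → d ≠ c →
    (sgn a b c = sgn c b d ↔ a ≠ d) := by decide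

/-- Of the two colours left over by an edge, each sign selects one. With `sgn_injective`, this
extends colourings over an ear in exactly one way. -/
theorem sgn_surjective : ∀ a b, a ≠ b → ∀ ε, ∃ p, a ≠ p ∧ p ≠ b ∧ sgn a p b = ε := by decide

theorem sgn_injective : ∀ a b p q, a ≠ b → a ≠ p → p ≠ b → a ≠ q → q ≠ b →
    sgn a p b = sgn a q b → p = q := by decide

theorem sgn_swap : ∀ i j, i ≠ j → ∀ a b c, a ≠ b → b ≠ c → c ≠ a →
    sgn (Equiv.swap i j a) (Equiv.swap i j b) (Equiv.swap i j c) = -sgn a b c := by decide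

/-- This is the sign rule of a 2-coloured flip, read off from a quadrilateral with four colours. -/
theorem sgn_quad : ∀ a b c d, a ≠ b → a ≠ c → a ≠ d → b ≠ c → b ≠ d → c ≠ d →
    sgn a c d = sgn a b c ∧ sgn a b d = -sgn a b c ∧ sgn b c d = -sgn a b c := by decide

theorem exists_ne_pair : ∀ a b : Fin 4, a ≠ b → ∃ p q, p ≠ q ∧ p ≠ a ∧ p ≠ b ∧ q ≠ a ∧ q ≠ b := by
  decide

theorem sgn_perm (σ : Equiv.Perm (Fin 4)) : ∃ ε : ℤˣ, ∀ a b c, a ≠ b → b ≠ c → c ≠ a →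
    sgn (σ a) (σ b) (σ c) = ε * sgn a b c := by
  induction σ using Equiv.Perm.swap_induction_on with
  | one => exact ⟨1, by simp⟩
  | swap_mul σ i j hij ih =>
    obtain ⟨ε, h⟩ := ih
    refine ⟨-ε, fun a b c h1 h2 h3 => ?_⟩
    simp only [Equiv.Perm.coe_mul, Function.comp_apply]
    rw [sgn_swap i j hij _ _ _ (σ.injective.ne h1) (σ.injective.ne h2) (σ.injective.ne h3),
      h a b c h1 h2 h3, neg_mul]

theorem exists_even_perm {a b a' b' : Fin 4} (h : a ≠ b) (h' : a' ≠ b') :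
    ∃ σ : Equiv.Perm (Fin 4), σ a = a' ∧ σ b = b' ∧
      ∀ x y z, x ≠ y → y ≠ z → z ≠ x → sgn (σ x) (σ y) (σ z) = sgn x y z := by
  obtain ⟨τ, h1, h2⟩ : ∃ τ : Equiv.Perm (Fin 4), τ a = a' ∧ τ b = b' := by
    refine ⟨Equiv.swap (Equiv.swap a a' b) b' * Equiv.swap a a', ?_, ?_⟩
    · simp only [Equiv.Perm.coe_mul, Function.comp_apply, Equiv.swap_apply_left]
      refine Equiv.swap_apply_of_ne_of_ne (fun h1 => h ?_) h'
      exact (Equiv.swap a a').injective (by rw [Equiv.swap_apply_left]; exact h1)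
    · simp
  obtain ⟨ε, hε⟩ := sgn_perm τ
  rcases Int.units_eq_one_or ε with rfl | rfl
  · exact ⟨τ, h1, h2, by simpa using hε⟩
  -- Parity is corrected by exchanging the two colours other than `a'` and `b'`.
  · obtain ⟨p, q, hpq, hp, hp', hq, hq'⟩ := exists_ne_pair a' b' h'
    refine ⟨Equiv.swap p q * τ, ?_, ?_, fun x y z hx hy hz => ?_⟩
    · simp [h1, Equiv.swap_apply_of_ne_of_ne hp.symm hq.symm]
    · simp [h2, Equiv.swap_apply_of_ne_of_ne hp'.symm hq'.symm]
    · simp only [Equiv.Perm.coe_mul, Function.comp_apply]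
      rw [sgn_swap p q hpq _ _ _ (τ.injective.ne hx) (τ.injective.ne hy) (τ.injective.ne hz),
        hε _ _ _ hx hy hz]
      simp

/-- The triangle `xyz`, in cyclic order, is a face of `G`. -/
structure IsOrientedFace (G : SimpleGraph (Fin n)) (x y z : Fin n) : Prop where
  cyc : Cyc x y z
  adj₁ : G.Adj x y
  adj₂ : G.Adj y z
  adj₃ : G.Adj z x

theorem IsOrientedFace.rotate {G : SimpleGraph (Fin n)} {x y z : Fin n}
    (h : IsOrientedFace G x y z) : IsOrientedFace G y z x :=
  ⟨by have := h.cyc; grind [Cyc], h.adj₂, h.adj₃, h.adj₁⟩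

theorem triple_rotate (x y z : Fin n) : ({y, z, x} : Finset (Fin n)) = {x, y, z} := by
  ext; simp only [Finset.mem_insert, Finset.mem_singleton]; tauto

/-- The signs `f` of the faces of `G` are the orientations of their colours. -/
structure Compatible (f : Finset (Fin n) → ℤˣ) (col : Fin n → Fin 4) (G : SimpleGraph (Fin n)) :
    Prop where
  proper : Proper col G
  sign : ∀ {x y z}, IsOrientedFace G x y z → f {x, y, z} = sgn (col x) (col y) (col z)

section

variable {S : Finset (Fin n)} {G : SimpleGraph (Fin n)} {f : Finset (Fin n) → ℤˣ}
  {col col' : Fin n → Fin 4}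

theorem IsTri.isOrientedFace_cases (h : IsTri S G) {u v w : Fin n} (he : IsEar S G u v w)
    {x y z : Fin n} (hf : IsOrientedFace G x y z) :
    IsOrientedFace (PolygonFlip.removeVertex G v) x y z ∨ (x = u ∧ y = v ∧ z = w) ∨
      (y = u ∧ z = v ∧ x = w) ∨ (z = u ∧ x = v ∧ y = w) := by
  have key : ∀ {x y z}, IsOrientedFace G x y z → y = v → x = u ∧ z = w := by
    rintro x y z hf rfl
    have h1 := (h.adj_ear_iff he).1 hf.adj₁.symm
    have h2 := (h.adj_ear_iff he).1 hf.adj₂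
    have := he.cyc
    have := hf.cyc
    grind [Cyc]
  by_cases hy : y = v
  · have := key hf hy; tauto
  by_cases hz : z = v
  · have := key hf.rotate hz; tauto
  by_cases hx : x = v
  · have := key hf.rotate.rotate hx; tauto
  exact .inl ⟨hf.cyc, ⟨hf.adj₁, hx, hy⟩, ⟨hf.adj₂, hy, hz⟩, ⟨hf.adj₃, hz, hx⟩⟩

theorem IsTri.isOrientedFace_ear (h : IsTri S G) {u v w : Fin n} (he : IsEar S G u v w) :
    IsOrientedFace G u v w :=
  ⟨he.cyc, h.adj_of_consec he.left, h.adj_of_consec he.right, he.adj.symm⟩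

theorem IsOrientedFace.of_removeVertex {v x y z : Fin n}
    (h : IsOrientedFace (removeVertex G v) x y z) : IsOrientedFace G x y z :=
  ⟨h.cyc, h.adj₁.1, h.adj₂.1, h.adj₃.1⟩

theorem Compatible.removeVertex (h : Compatible f col G) (v : Fin n) :
    Compatible f col (PolygonFlip.removeVertex G v) :=
  ⟨h.proper.removeVertex v, fun hf => h.sign hf.of_removeVertex⟩

theorem IsTri.compatible_of_ear (h : IsTri S G) {u v w : Fin n} (he : IsEar S G u v w)
    (hc : Compatible f col (PolygonFlip.removeVertex G v)) (h1 : col u ≠ col v)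
    (h2 : col v ≠ col w) (h3 : f {u, v, w} = sgn (col u) (col v) (col w)) :
    Compatible f col G := by
  constructor
  · rw [← h.addVertex_removeVertex he]
    exact hc.proper.addVertex he.left.2.2.1 he.right.2.2.1 h1 h2
  · intro x y z hf
    have h4 : col w ≠ col u := by
      have huv := he.left.2.2.1
      exact hc.proper _ _ ⟨he.adj.symm, he.right.2.2.1.symm, huv⟩
    rcases h.isOrientedFace_cases he hf with h | ⟨rfl, rfl, rfl⟩ | ⟨rfl, rfl, rfl⟩ | ⟨rfl, rfl, rfl⟩
    · exact hc.sign h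
    · exact h3
    · rw [← triple_rotate, ← sgn_rotate _ _ _ h4 h1 h2, h3]
    · rw [triple_rotate, sgn_rotate _ _ _ h1 h2 h4, h3]

theorem IsTri.exists_compatible (h : IsTri S G) (hS : 2 ≤ S.card) :
    ∃ col, Compatible f col G := by
  induction hk : S.card - 2 generalizing S G with
  | zero =>
    obtain ⟨x, y, hxy, rfl⟩ := Finset.card_eq_two.1 (by omega : S.card = 2)
    have hm : ∀ {a b}, G.Adj a b → (a = x ∨ a = y) ∧ (b = x ∨ b = y) := fun hab => by
      have h1 := h.mem hab
      have h2 := h.mem_right hab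
      simp_all
    refine ⟨fun z => if z = x then 0 else 1, fun a b hab => ?_, fun {a b c} hf => ?_⟩
    · have := hm hab
      have := hab.ne
      grind
    · have := hm hf.adj₁
      have := hm hf.adj₂
      have := hf.cyc
      grind [Cyc]
  | succ k ih =>
    obtain ⟨u, v, w, he⟩ := h.exists_isEar (by omega)
    obtain ⟨col, hc⟩ := ih (h.removeVertex he)
      (by rw [Finset.card_erase_of_mem he.left.2.1]; omega)
      (by rw [Finset.card_erase_of_mem he.left.2.1]; omega)
    have huv := he.left.2.2.1
    have hwv := he.right.2.2.1.symm
    obtain ⟨p, hp1, hp2, hp3⟩ := sgn_surjective (col u) (col w)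
      (hc.proper _ _ ⟨he.adj, huv, hwv⟩) (f {u, v, w})
    refine ⟨Function.update col v p, h.compatible_of_ear he ⟨fun x y hxy => ?_, fun hf => ?_⟩
      ?_ ?_ ?_⟩
    · simp only [Function.update_of_ne hxy.2.1, Function.update_of_ne hxy.2.2]
      exact hc.proper x y hxy
    · simp only [Function.update_of_ne hf.adj₁.2.1, Function.update_of_ne hf.adj₂.2.1,
        Function.update_of_ne hf.adj₃.2.1]
      exact hc.sign hf
    · simpa [huv] using hp1
    · simpa [hwv] using hp2
    · simpa [huv, hwv] using hp3.symm

/-- An even permutation is fixed by its values on the two colours of a base edge, and agreement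
propagates over ears because edge colours and sign determine the third colour. -/
theorem IsTri.exists_perm_of_compatible (h : IsTri S G) (hS : 2 ≤ S.card)
    (hc : Compatible f col G) (hc' : Compatible f col' G) :
    ∃ σ : Equiv.Perm (Fin 4), (∀ x ∈ S, col' x = σ (col x)) ∧
      ∀ x y z, x ≠ y → y ≠ z → z ≠ x → sgn (σ x) (σ y) (σ z) = sgn x y z := by
  induction hk : S.card - 2 generalizing S G with
  | zero =>
    obtain ⟨x, y, hxy, rfl⟩ := Finset.card_eq_two.1 (by omega : S.card = 2)
    have hadj : G.Adj x y := h.adj_of_consec ⟨by simp, by simp, hxy, by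
      simp only [Finset.mem_insert, Finset.mem_singleton]; grind [Cyc]⟩
    obtain ⟨σ, h1, h2, h3⟩ := exists_even_perm (hc.proper _ _ hadj) (hc'.proper _ _ hadj)
    exact ⟨σ, by simp [h1, h2], h3⟩
  | succ k ih =>
    obtain ⟨u, v, w, he⟩ := h.exists_isEar (by omega)
    obtain ⟨σ, h1, h2⟩ := ih (h.removeVertex he)
      (by rw [Finset.card_erase_of_mem he.left.2.1]; omega) (hc.removeVertex v)
      (hc'.removeVertex v) (by rw [Finset.card_erase_of_mem he.left.2.1]; omega)
    refine ⟨σ, fun x hx => ?_, h2⟩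
    by_cases hxv : x = v
    · subst hxv
      have hf := h.isOrientedFace_ear he
      have e1 := h1 u (Finset.mem_erase.2 ⟨he.left.2.2.1, he.left.1⟩)
      have e2 := h1 w (Finset.mem_erase.2 ⟨he.right.2.2.1.symm, he.right.2.1⟩)
      have a1 := hc.proper _ _ hf.adj₁
      have a2 := hc.proper _ _ hf.adj₂
      have a3 := hc.proper _ _ hf.adj₃
      refine sgn_injective (col' u) (col' w) _ _ (hc'.proper _ _ he.adj)
        (hc'.proper _ _ hf.adj₁) (hc'.proper _ _ hf.adj₂) ?_ ?_ ?_
      · rw [e1]; exact σ.injective.ne a1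
      · rw [e2]; exact σ.injective.ne a2
      · rw [← hc'.sign hf, e1, e2, h2 _ _ _ a1 a2 a3, hc.sign hf]
    · exact h1 x (Finset.mem_erase.2 ⟨hxv, hx⟩)

/-- Adjacent faces have the same sign if and only if their opposite vertices have different
colours. -/
def LocallyCompatible (f : Finset (Fin n) → ℤˣ) (col : Fin n → Fin 4) (G : SimpleGraph (Fin n)) :
    Prop :=
  ∀ x y z w, IsOrientedFace G x y z → IsOrientedFace G z y w →
    (f {x, y, z} = f {z, y, w} ↔ col x ≠ col w)

theorem Compatible.locallyCompatible (h : Compatible f col G) : LocallyCompatible f col G := by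
  intro x y z w hf hf'
  rw [h.sign hf, h.sign hf']
  exact sgn_eq_iff _ _ _ _ (h.proper _ _ hf.adj₁) (h.proper _ _ hf.adj₂) (h.proper _ _ hf.adj₃)
    (h.proper _ _ hf'.adj₂) (h.proper _ _ hf'.adj₃)

theorem eq_mul_of_iff : ∀ {ε s t s' t' : ℤˣ}, (s = t ↔ s' = t') → ε * t = t' → ε * s = s' := by
  decide

/-- The sign `ε` is read off from a single triangle. When an ear is added, the local condition
across its base `uw` forces the same `ε` for the ear. -/
theorem IsTri.compatible_of_locallyCompatible (h : IsTri S G) (hS : 3 ≤ S.card)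
    (hp : Proper col G) (hl : LocallyCompatible f col G) :
    ∃ ε : ℤˣ, Compatible (fun t => ε * f t) col G := by
  induction hk : S.card - 3 generalizing S G with
  | zero =>
    obtain ⟨u, v, w, he⟩ := h.exists_isEar (by omega)
    have hf := h.isOrientedFace_ear he
    refine ⟨f {u, v, w} * sgn (col u) (col v) (col w), h.compatible_of_ear he
      ⟨hp.removeVertex v, fun {x y z} hf' => ?_⟩ (hp _ _ hf.adj₁) (hp _ _ hf.adj₂) ?_⟩
    · have hsub : {x, y, z} ⊆ S.erase v := by
        have hT := h.removeVertex he
        simp only [Finset.insert_subset_iff, Finset.singleton_subset_iff]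
        exact ⟨hT.mem hf'.adj₁, hT.mem hf'.adj₂, hT.mem hf'.adj₃⟩
      have := Finset.card_le_card hsub
      rw [Finset.card_erase_of_mem he.left.2.1, Finset.card_eq_three.2
        ⟨x, y, z, hf'.adj₁.ne, hf'.adj₃.ne', hf'.adj₂.ne, rfl⟩] at this
      omega
    · rw [mul_right_comm, Int.units_mul_self, one_mul]
  | succ k ih =>
    obtain ⟨u, v, w, he⟩ := h.exists_isEar (by omega)
    have hT := h.removeVertex he
    have hcard : (S.erase v).card = k + 3 := by
      rw [Finset.card_erase_of_mem he.left.2.1]; omega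
    obtain ⟨ε, hc⟩ := ih hT (by omega) (hp.removeVertex v)
      (fun x y z w h1 h2 => hl x y z w h1.of_removeVertex h2.of_removeVertex) (by omega)
    have hf := h.isOrientedFace_ear he
    refine ⟨ε, h.compatible_of_ear he hc (hp _ _ hf.adj₁) (hp _ _ hf.adj₂) ?_⟩
    obtain ⟨p, hpS, h1⟩ := Finset.exists_mem_notMem_of_card_lt_card
      (s := {u, w}) (t := S.erase v) (lt_of_le_of_lt Finset.card_le_two (by omega))
    simp only [Finset.mem_insert, Finset.mem_singleton, not_or] at h1
    have hcons := Consec.erase_mid he.left he.right he.ne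
    obtain ⟨z, hz, hwz, hzu⟩ := hT.exists_face (hT.adj_of_consec hcons).symm hpS
      (by have := hcons.cyc hpS h1.1 h1.2; grind [Cyc])
    have hf' : IsOrientedFace (PolygonFlip.removeVertex G v) u w z :=
      ⟨by grind [Cyc], hT.adj_of_consec hcons, hwz, hzu⟩
    have e1 := hl v w u z hf.rotate hf'.of_removeVertex
    rw [← sgn_eq_iff _ (col w) (col u) _ (hp _ _ hf.adj₂) (hp _ _ hf.adj₃) (hp _ _ hf.adj₁)
      (hp _ _ hf'.of_removeVertex.adj₂) (hp _ _ hf'.of_removeVertex.adj₃)] at e1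
    rw [← triple_rotate u v w, ← sgn_rotate _ _ _ (hp _ _ hf.adj₁) (hp _ _ hf.adj₂) (hp _ _ hf.adj₃)]
    exact eq_mul_of_iff e1 (hc.sign hf')

end

end PolygonFlip

/-! ### Translation between the stated definitions and graphs with oriented faces -/

namespace PolygonFlip

variable {n : ℕ}

theorem crosses_iff {x y z w : Fin n} : Crosses s(x, y) s(z, w) ↔ Cr x y z w := by
  constructor
  · rintro ⟨a, b, c, d, h1, h2, h3, h⟩
    simp only [Sym2.eq_iff] at h
    grind [Cr, Cyc]
  · intro h
    have key : ∀ {x y z w : Fin n}, x < y → z < w → Cr x y z w → Crosses s(x, y) s(z, w) := by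
      intro x y z w h1 h2 h
      by_cases hxz : x < z
      · exact ⟨x, z, y, w, by grind [Cr, Cyc], by grind [Cr, Cyc], by grind [Cr, Cyc],
          .inl ⟨rfl, rfl⟩⟩
      · exact ⟨z, x, w, y, by grind [Cr, Cyc], by grind [Cr, Cyc], by grind [Cr, Cyc],
          .inr ⟨rfl, rfl⟩⟩
    have hxy : x ≠ y := by grind [Cr, Cyc]
    have hzw : z ≠ w := by grind [Cr, Cyc]
    rcases lt_or_gt_of_ne hxy with h1 | h1 <;> rcases lt_or_gt_of_ne hzw with h2 | h2
    · exact key h1 h2 h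
    · rw [Sym2.eq_swap (a := z)]; exact key h1 h2 h.comm.swap.comm
    · rw [Sym2.eq_swap (a := x)]; exact key h1 h2 h.swap
    · rw [Sym2.eq_swap (a := x), Sym2.eq_swap (a := z)]; exact key h1 h2 h.swap.comm.swap.comm

theorem IsSide.not_cr {x y z w : Fin n} (h : IsSide s(x, y)) : ¬ Cr x y z w := by
  have key : ∀ {i j z w : Fin n}, (j : ℕ) = (i + 1) % n → ¬ Cr i j z w := by
    intro i j z w h
    -- The second case is the wrap-around side from the last vertex to `0`.
    have h1 : (j : ℕ) = i + 1 ∨ ((j : ℕ) = 0 ∧ (i : ℕ) + 1 = n) := by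
      rcases (Nat.succ_le_of_lt i.2).lt_or_eq with h2 | h2
      · left; rw [h, Nat.mod_eq_of_lt h2]
      · right; refine ⟨?_, h2⟩; rw [h, ← Nat.succ_eq_add_one, h2, Nat.mod_self]
    have h2 : ∀ z, ¬ Cyc i z j := fun z => by
      have := z.2
      grind [Cyc]
    grind [Cr]
  obtain ⟨i, j, hij, h⟩ := h
  rcases Sym2.eq_iff.1 h with ⟨rfl, rfl⟩ | ⟨rfl, rfl⟩
  · exact key hij
  · exact fun hc => key hij hc.swap

theorem isDiagonal_of_cr {x y z w : Fin n} (h : Cr x y z w) : IsDiagonal s(x, y) :=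
  ⟨fun hd => by rw [Sym2.mk_isDiag_iff] at hd; grind [Cr, Cyc], fun hs => hs.not_cr h⟩

namespace Triangulation

/-- The graph formed by the sides of the polygon and the diagonals of `T`. -/
def graph (T : Triangulation n) : SimpleGraph (Fin n) where
  Adj x y := x ≠ y ∧ T.IsEdge s(x, y)
  symm := ⟨fun x y h => ⟨h.1.symm, by rw [Sym2.eq_swap]; exact h.2⟩⟩
  loopless := ⟨fun _ h => h.1 rfl⟩

theorem mem_diagonals_iff (T : Triangulation n) {x y : Fin n} :
    s(x, y) ∈ T.diagonals ↔ IsDiagonal s(x, y) ∧ T.graph.Adj x y := by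
  constructor
  · intro h
    have hd := T.isDiagonal _ h
    exact ⟨hd, fun hxy => hd.1 (Sym2.mk_isDiag_iff.2 hxy), .inr h⟩
  · rintro ⟨hd, -, hs | h⟩
    exacts [(hd.2 hs).elim, h]

theorem isTri (T : Triangulation n) : IsTri Finset.univ T.graph := by
  refine ⟨fun _ => Finset.mem_univ _, fun {x y z w} hxy hzw hc => ?_, fun {x y} _ _ hxy hmax => ?_⟩
  · have h1 := T.mem_diagonals_iff.2 ⟨isDiagonal_of_cr hc, hxy⟩
    have h2 := T.mem_diagonals_iff.2 ⟨isDiagonal_of_cr hc.comm, hzw⟩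
    exact T.noncrossing _ h1 _ h2 (crosses_iff.2 hc)
  · by_cases hs : IsSide s(x, y)
    · exact ⟨hxy, .inl hs⟩
    refine ⟨hxy, .inr (T.maximal _ ⟨fun h => hxy (Sym2.mk_isDiag_iff.1 h), hs⟩ fun e he hc => ?_)⟩
    induction e with
    | _ z w => exact hmax z w (T.mem_diagonals_iff.1 he).2 (crosses_iff.1 hc).comm

theorem graph_injective : Function.Injective (graph (n := n)) := by
  intro T T' h
  ext e
  induction e with
  | _ x y => rw [mem_diagonals_iff, mem_diagonals_iff, h]

open Classical in
/-- The triangulation with a given graph. -/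
noncomputable def ofGraph (G : SimpleGraph (Fin n)) (hG : IsTri Finset.univ G) :
    Triangulation n where
  diagonals := Finset.univ.filter fun e => IsDiagonal e ∧ e ∈ G.edgeSet
  isDiagonal e he := (Finset.mem_filter.1 he).2.1
  noncrossing e he f hf := by
    have he := (Finset.mem_filter.1 he).2.2
    have hf := (Finset.mem_filter.1 hf).2.2
    induction e with
    | _ x y =>
      induction f with
      | _ z w => exact fun hc => hG.noncross he hf (crosses_iff.1 hc)
  maximal f hf h := by
    induction f with
    | _ x y =>
      refine Finset.mem_filter.2 ⟨Finset.mem_univ _, hf, hG.maximal (Finset.mem_univ _)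
        (Finset.mem_univ _) (fun h => hf.1 (Sym2.mk_isDiag_iff.2 h)) fun z w hzw hc => ?_⟩
      exact h s(z, w) (Finset.mem_filter.2 ⟨Finset.mem_univ _, isDiagonal_of_cr hc.comm, hzw⟩)
        (crosses_iff.2 hc.comm)

theorem graph_ofGraph (G : SimpleGraph (Fin n)) (hG : IsTri Finset.univ G) :
    (ofGraph G hG).graph = G := by
  ext x y
  by_cases hxy : x = y
  · simp [hxy]
  by_cases hs : IsSide s(x, y)
  · exact iff_of_true ⟨hxy, .inl hs⟩ (hG.maximal (Finset.mem_univ _) (Finset.mem_univ _) hxy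
      fun z w _ => hs.not_cr)
  · have hd : IsDiagonal s(x, y) := ⟨fun h => hxy (Sym2.mk_isDiag_iff.1 h), hs⟩
    have h1 := (ofGraph G hG).mem_diagonals_iff (x := x) (y := y)
    have h2 : s(x, y) ∈ (ofGraph G hG).diagonals ↔ IsDiagonal s(x, y) ∧ G.Adj x y := by
      simp [ofGraph]
    tauto

theorem IsFace.adj {T : Triangulation n} {x y z : Fin n} (h : T.IsFace {x, y, z}) :
    T.graph.Adj x y ∧ T.graph.Adj y z ∧ T.graph.Adj z x := by
  have hxy : x ≠ y := by
    rintro rfl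
    have h1 := h.1
    rw [Finset.insert_eq_of_mem (Finset.mem_insert_self _ _)] at h1
    exact absurd h1 (by have := Finset.card_le_two (a := x) (b := z); omega)
  have hyz : y ≠ z := by
    rintro rfl
    have h1 := h.1
    rw [Finset.pair_eq_singleton] at h1
    exact absurd h1 (by have := Finset.card_le_two (a := x) (b := y); omega)
  have hzx : z ≠ x := by
    rintro rfl
    have h1 := h.1
    rw [Finset.insert_eq_of_mem (by simp)] at h1
    exact absurd h1 (by have := Finset.card_le_two (a := y) (b := z); omega)
  exact ⟨⟨hxy, h.2 _ (by simp) _ (by simp) hxy⟩, ⟨hyz, h.2 _ (by simp) _ (by simp) hyz⟩,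
    ⟨hzx, h.2 _ (by simp) _ (by simp) hzx⟩⟩

theorem IsFace.isOrientedFace {T : Triangulation n} {x y z : Fin n} (h : T.IsFace {x, y, z})
    (hc : Cyc x y z) : IsOrientedFace T.graph x y z :=
  ⟨hc, h.adj.1, h.adj.2.1, h.adj.2.2⟩

theorem isFace_of_isOrientedFace {T : Triangulation n} {x y z : Fin n}
    (h : IsOrientedFace T.graph x y z) : T.IsFace {x, y, z} := by
  refine ⟨Finset.card_eq_three.2 ⟨x, y, z, h.adj₁.ne, h.adj₃.ne', h.adj₂.ne, rfl⟩, ?_⟩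
  have h1 := h.adj₁.2
  have h2 := h.adj₂.2
  have h3 := h.adj₃.2
  have h1' := h.adj₁.symm.2
  have h2' := h.adj₂.symm.2
  have h3' := h.adj₃.symm.2
  intro a ha b hb hab
  simp only [Finset.mem_insert, Finset.mem_singleton] at ha hb
  rcases ha with rfl | rfl | rfl <;> rcases hb with rfl | rfl | rfl <;>
    first | exact (hab rfl).elim | assumption

theorem IsFace.exists_eq {T : Triangulation n} {t : Finset (Fin n)} (h : T.IsFace t) :
    ∃ x y z, t = {x, y, z} ∧ IsOrientedFace T.graph x y z := by
  obtain ⟨x, y, z, hxy, hxz, hyz, rfl⟩ := Finset.card_eq_three.1 h.1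
  by_cases hc : Cyc x y z
  · exact ⟨x, y, z, rfl, h.isOrientedFace hc⟩
  · have hc' : Cyc x z y := by grind [Cyc]
    have he : ({x, y, z} : Finset (Fin n)) = {x, z, y} := by rw [Finset.pair_comm]
    rw [he] at h
    exact ⟨x, z, y, he, h.isOrientedFace hc'⟩

end Triangulation

open Classical in
/-- The orientation of the colours of the triangle with vertex set `t`. -/
noncomputable def orientation (col : Fin n → Fin 4) (t : Finset (Fin n)) : ℤˣ :=
  if ∃ x y z, Cyc x y z ∧ t = {x, y, z} ∧ sgn (col x) (col y) (col z) = 1 then 1 else -1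

theorem orientation_eq {col : Fin n → Fin 4} {x y z : Fin n} (hc : Cyc x y z)
    (h1 : col x ≠ col y) (h2 : col y ≠ col z) (h3 : col z ≠ col x) :
    orientation col {x, y, z} = sgn (col x) (col y) (col z) := by
  rw [orientation]
  split_ifs with h
  · obtain ⟨x', y', z', hc', ht, hs⟩ := h
    have hm : ∀ a, (a = x ∨ a = y ∨ a = z) ↔ (a = x' ∨ a = y' ∨ a = z') := fun a => by
      simpa using Finset.ext_iff.1 ht a
    have hx := (hm x').2 (by simp)
    have hy := (hm y').2 (by simp)
    have hz := (hm z').2 (by simp)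
    -- Cyclic listings of the same triple differ by a rotation, which `sgn` ignores.
    have : (x' = x ∧ y' = y ∧ z' = z) ∨ (x' = y ∧ y' = z ∧ z' = x) ∨
        (x' = z ∧ y' = x ∧ z' = y) := by
      clear hm ht hs h1 h2 h3
      rcases hx with rfl | rfl | rfl <;> grind [Cyc]
    rcases this with ⟨rfl, rfl, rfl⟩ | ⟨rfl, rfl, rfl⟩ | ⟨rfl, rfl, rfl⟩
    · exact hs.symm
    · rw [← hs, sgn_rotate _ _ _ h1 h2 h3]
    · rw [← hs, ← sgn_rotate _ _ _ h3 h1 h2]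
  · push Not at h
    rcases Int.units_eq_one_or (sgn (col x) (col y) (col z)) with hs | hs
    · exact (h x y z hc rfl hs).elim
    · exact hs.symm

namespace TwoColouredTriangulation

open Classical in
/-- The signs of the triangles, as a function on all sets of vertices. -/
noncomputable def faceSign (A : TwoColouredTriangulation n) (t : Finset (Fin n)) : ℤˣ :=
  -- The value off the faces is a default; compatibility inspects faces only.
  if h : A.T.IsFace t then A.sign ⟨t, h⟩ else 1

theorem faceSign_eq (A : TwoColouredTriangulation n) {t : Finset (Fin n)} (h : A.T.IsFace t) :
    A.faceSign t = A.sign ⟨t, h⟩ :=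
  dif_pos h

theorem eq_of_faceSign {A B : TwoColouredTriangulation n} (h : A.T = B.T)
    (h' : ∀ t, A.T.IsFace t → A.faceSign t = B.faceSign t) : A = B := by
  obtain ⟨T, s⟩ := A
  obtain ⟨T', s'⟩ := B
  obtain rfl : T = T' := h
  congr
  ext1 ⟨t, ht⟩
  have := h' t ht
  rwa [faceSign_eq _ ht, faceSign_eq _ ht] at this

/-- The signs of `A` are the orientations of the colours of its triangles. -/
def CompatibleWith (A : TwoColouredTriangulation n) (col : Fin n → Fin 4) : Prop :=
  Compatible A.faceSign col A.T.graph

theorem CompatibleWith.eq {A B : TwoColouredTriangulation n} {col : Fin n → Fin 4}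
    (hA : A.CompatibleWith col) (hB : B.CompatibleWith col) (h : A.T.graph = B.T.graph) :
    A = B := by
  refine eq_of_faceSign (Triangulation.graph_injective h) fun t ht => ?_
  obtain ⟨x, y, z, rfl, hf⟩ := ht.exists_eq
  rw [hA.sign hf, hB.sign (h ▸ hf)]

theorem exists_compatibleWith_of_graph {G : SimpleGraph (Fin n)} (hG : IsTri Finset.univ G)
    {col : Fin n → Fin 4} (hp : Proper col G) :
    ∃ A : TwoColouredTriangulation n, A.T.graph = G ∧ A.CompatibleWith col := by
  have h := Triangulation.graph_ofGraph G hG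
  refine ⟨⟨Triangulation.ofGraph G hG, fun t => orientation col t⟩, h, ?_, fun {x y z} hf => ?_⟩
  · rwa [h]
  · rw [faceSign_eq _ (Triangulation.isFace_of_isOrientedFace hf)]
    rw [h] at hf
    exact orientation_eq hf.cyc (hp _ _ hf.adj₁) (hp _ _ hf.adj₂) (hp _ _ hf.adj₃)

theorem faceSign_neg (A : TwoColouredTriangulation n) {t : Finset (Fin n)} (h : A.T.IsFace t) :
    A.neg.faceSign t = -A.faceSign t := by
  rw [faceSign_eq A h, faceSign_eq A.neg h]
  rfl

/-- No triangles other than these two contain the diagonal, one on each side by `face_unique`, so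
the quantifier in the valuation reduces to comparing their signs. -/
theorem valuation_eq_one_iff (A : TwoColouredTriangulation n) {x y z w : Fin n}
    (h : s(y, z) ∈ A.T.diagonals) (h1 : IsOrientedFace A.T.graph x y z)
    (h2 : IsOrientedFace A.T.graph z y w) :
    A.valuation ⟨s(y, z), h⟩ = 1 ↔ A.faceSign {x, y, z} ≠ A.faceSign {z, y, w} := by
  have f1 := Triangulation.isFace_of_isOrientedFace h1
  have f2 := Triangulation.isFace_of_isOrientedFace h2
  have hcases : ∀ t, A.T.IsFace t → (∀ a ∈ s(y, z), a ∈ t) → t = {x, y, z} ∨ t = {z, y, w} := by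
    have key : ∀ {p q r}, IsOrientedFace A.T.graph p q r → q = y → r = z ∨ p = z →
        ({p, q, r} : Finset (Fin n)) = {x, y, z} ∨ ({p, q, r} : Finset (Fin n)) = {z, y, w} := by
      rintro p q r hf rfl (rfl | rfl)
      · left
        rw [A.T.isTri.face_unique (z := p) (w := x) (x := r) (y := q)
          (by have := hf.cyc; grind [Cyc]) (by have := h1.cyc; grind [Cyc]) hf.adj₃ hf.adj₁
          h1.adj₃ h1.adj₁]
      · right
        rw [A.T.isTri.face_unique (z := r) (w := w) (x := q) (y := p)
          (by have := hf.cyc; grind [Cyc]) (by have := h2.cyc; grind [Cyc]) hf.adj₂ hf.adj₃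
          h2.adj₂ h2.adj₃]
    intro t ht hmem
    obtain ⟨p, q, r, rfl, hf⟩ := ht.exists_eq
    have hy := hmem y (by simp)
    have hz := hmem z (by simp)
    have hyz := h1.adj₂.ne
    simp only [Finset.mem_insert, Finset.mem_singleton] at hy hz
    rcases hy with rfl | rfl | rfl
    · rw [triple_rotate r y q]
      exact key hf.rotate.rotate rfl (by tauto)
    · exact key hf rfl (by tauto)
    · rw [← triple_rotate p q y]
      exact key hf.rotate rfl (by tauto)
  rw [valuation]
  split_ifs with hv
  · refine iff_of_false (by decide) (not_not.2 ?_)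
    rw [faceSign_eq _ f1, faceSign_eq _ f2]
    exact hv ⟨_, f1⟩ ⟨_, f2⟩ (by simp) (by simp)
  · refine iff_of_true rfl fun he => hv ?_
    rintro ⟨t, ht⟩ ⟨u, hu⟩ ht' hu'
    rw [← faceSign_eq A ht, ← faceSign_eq A hu]
    rcases hcases t ht ht' with rfl | rfl <;> rcases hcases u hu hu' with rfl | rfl <;>
      first | rfl | exact he | exact he.symm

theorem inducesColouring_iff {A : TwoColouredTriangulation n} {col : Fin n → Fin 4} :
    A.InducesColouring col ↔
      Proper col A.T.graph ∧ LocallyCompatible A.faceSign col A.T.graph := by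
  constructor
  · rintro ⟨h1, h2⟩
    refine ⟨fun x y hxy => h1 x y hxy.1 hxy.2, fun x y z w hf hf' => ?_⟩
    have hcr : Cr y z x w := by
      have := hf.cyc
      have := hf'.cyc
      grind [Cr, Cyc]
    have hd := A.T.mem_diagonals_iff.2 ⟨isDiagonal_of_cr hcr, hf.adj₂⟩
    have h3 := h2 x y z w hd (Triangulation.isFace_of_isOrientedFace hf) (by
      have := Triangulation.isFace_of_isOrientedFace hf'
      rwa [Finset.insert_comm] at this) (by rintro rfl; grind [Cr, Cyc])
    rw [A.valuation_eq_one_iff hd hf hf'] at h3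
    tauto
  · rintro ⟨h1, h2⟩
    refine ⟨fun x y hxy he => h1 x y ⟨hxy, he⟩, fun x y z w hd hf hf' hxw => ?_⟩
    have key : ∀ {y z} (hd : s(y, z) ∈ A.T.diagonals), A.T.IsFace {x, y, z} →
        A.T.IsFace {y, z, w} → Cyc x y z → (col x = col w ↔ A.valuation ⟨s(y, z), hd⟩ = 1) := by
      intro y z hd hf hf' hc
      have g1 := hf.isOrientedFace hc
      have hc' : Cyc z y w := by
        by_contra hc'
        have := hf'.adj.1.ne
        have := hf'.adj.2.1.ne
        have := hf'.adj.2.2.ne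
        exact hxw (A.T.isTri.face_unique (x := z) (y := y) (by grind [Cyc]) (by grind [Cyc])
          g1.adj₃ g1.adj₁ hf'.adj.2.1 hf'.adj.2.2)
      rw [Finset.insert_comm] at hf'
      have g2 := hf'.isOrientedFace hc'
      have := h2 _ _ _ _ g1 g2
      rw [A.valuation_eq_one_iff hd g1 g2]
      tauto
    by_cases hc : Cyc x y z
    · exact key hd hf hf' hc
    · have hc' : Cyc x z y := by
        have := hf.adj.1.ne
        have := hf.adj.2.1.ne
        have := hf.adj.2.2.ne
        grind [Cyc]
      have := key (y := z) (z := y) (by rwa [Sym2.eq_swap]) (by rwa [Finset.pair_comm])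
        (by rwa [Finset.insert_comm]) hc'
      rw [this]
      simp only [Sym2.eq_swap]

end TwoColouredTriangulation

end PolygonFlip

/-! ### 2-coloured flips as properly coloured flips -/

namespace PolygonFlip

variable {n : ℕ}

theorem eq_of_four_ne : ∀ a b c d : Fin 4, a ≠ b → a ≠ c → a ≠ d → b ≠ c → b ≠ d → c ≠ d →
    ∀ k, k = a ∨ k = b ∨ k = c ∨ k = d := by
  decide

theorem Compatible.perm {f : Finset (Fin n) → ℤˣ} {col : Fin n → Fin 4}
    {G : SimpleGraph (Fin n)} (h : Compatible f col G) {σ : Equiv.Perm (Fin 4)} {ε : ℤˣ}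
    (hσ : ∀ a b c, a ≠ b → b ≠ c → c ≠ a → sgn (σ a) (σ b) (σ c) = ε * sgn a b c) :
    Compatible (fun t => ε * f t) (σ ∘ col) G := by
  refine ⟨fun x y hxy => σ.injective.ne (h.proper x y hxy), fun hf => ?_⟩
  simp only [Function.comp_apply]
  rw [hσ _ _ _ (h.proper _ _ hf.adj₁) (h.proper _ _ hf.adj₂) (h.proper _ _ hf.adj₃), h.sign hf]

namespace TwoColouredTriangulation

variable {A B : TwoColouredTriangulation n} {col : Fin n → Fin 4}

/-- The quadrilateral of a flip has four different colours. -/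
theorem CompatibleWith.ne_of_quad (hA : A.CompatibleWith col) {a b c d : Fin n}
    (hq : IsQuad A.T.graph a b c d) (hs : A.faceSign {a, b, c} = A.faceSign {a, c, d}) :
    col b ≠ col d := by
  have h1 : IsOrientedFace A.T.graph b c a :=
    ⟨by have := hq.cyc_left; grind [Cyc], hq.adj₂, hq.diag.symm, hq.adj₁⟩
  have h2 : IsOrientedFace A.T.graph a c d :=
    ⟨by have := hq.cyc_right; grind [Cyc], hq.diag, hq.adj₃, hq.adj₄⟩
  refine (hA.locallyCompatible b c a d h1 h2).1 ?_
  rwa [triple_rotate]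

theorem graph_eq_flip {a b c d : Fin n} (hq : IsQuad A.T.graph a b c d)
    (hac : s(a, c) ∈ A.T.diagonals)
    (hB : B.T.diagonals = insert s(b, d) (A.T.diagonals.erase s(a, c))) :
    B.T.graph = flip A.T.graph a b c d := by
  have hdiag := A.T.isDiagonal _ hac
  ext x y
  rw [flip_adj hq.ne]
  simp only [Triangulation.graph, Triangulation.IsEdge, hB, Finset.mem_insert, Finset.mem_erase]
  have h1 : s(x, y) = s(b, d) ↔ (x = b ∧ y = d) ∨ (x = d ∧ y = b) := Sym2.eq_iff
  have h2 : s(x, y) = s(a, c) ↔ (x = a ∧ y = c) ∨ (x = c ∧ y = a) := Sym2.eq_iff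
  have h3 : s(x, y) = s(a, c) → ¬ IsSide s(x, y) := fun h => h ▸ hdiag.2
  have h4 := hq.ne
  grind

/-- Equal signs make the quadrilateral four-coloured, so all colours occur, and `sgn_quad` matches
the prescribed new signs with the orientations of the new triangles. -/
theorem CompatibleWith.of_quad (hA : A.CompatibleWith col) {a b c d : Fin n}
    (hq : IsQuad A.T.graph a b c d) (hac : s(a, c) ∈ A.T.diagonals)
    (hB : B.T.diagonals = insert s(b, d) (A.T.diagonals.erase s(a, c)))
    (hs : A.faceSign {a, b, c} = A.faceSign {a, c, d})
    (hs₁ : B.faceSign {a, b, d} = -A.faceSign {a, b, c})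
    (hs₂ : B.faceSign {b, c, d} = -A.faceSign {a, b, c})
    (hs₃ : ∀ t, A.T.IsFace t → B.T.IsFace t → B.faceSign t = A.faceSign t) :
    B.CompatibleWith col ∧ Function.Surjective col := by
  have hbd := hA.ne_of_quad hq hs
  have hg := graph_eq_flip hq hac hB
  have n1 := hA.proper _ _ hq.adj₁
  have n2 := hA.proper _ _ hq.diag
  have n3 := (hA.proper _ _ hq.adj₄).symm
  have n4 := hA.proper _ _ hq.adj₂
  have n6 := hA.proper _ _ hq.adj₃
  obtain ⟨-, e1, e2⟩ := sgn_quad _ _ _ _ n1 n2 n3 n4 hbd n6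
  have habc : A.faceSign {a, b, c} = sgn (col a) (col b) (col c) :=
    hA.sign ⟨hq.cyc_left, hq.adj₁, hq.adj₂, hq.diag.symm⟩
  rw [habc, ← e1] at hs₁
  rw [habc, ← e2] at hs₂
  have hp := hA.proper.flip hq hbd
  have hq' := hq.flip
  have hT := A.T.isTri.flip hq
  refine ⟨⟨hg ▸ hp, fun {x y z} hf => ?_⟩, fun k => ?_⟩
  · have key : ∀ {x y z}, IsOrientedFace B.T.graph x y z →
        (x = b ∧ y = d) ∨ (x = d ∧ y = b) →
        B.faceSign {x, y, z} = sgn (col x) (col y) (col z) := by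
      intro x y z hf hxy
      rw [hg] at hf
      rcases hxy with ⟨rfl, rfl⟩ | ⟨rfl, rfl⟩
      · obtain rfl : z = a := hT.face_unique (by have := hf.cyc; grind [Cyc])
          (by have := hq'.cyc_right; grind [Cyc]) hf.adj₂ hf.adj₃ hq'.adj₃ hq'.adj₄
        rw [triple_rotate z, hs₁, sgn_rotate _ _ _ n1 hbd n3.symm]
      · obtain rfl : z = c := hT.face_unique (by have := hf.cyc; grind [Cyc])
          (by have := hq'.cyc_left; grind [Cyc]) hf.adj₂ hf.adj₃ hq'.adj₁ hq'.adj₂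
        rw [← triple_rotate, hs₂, sgn_rotate _ _ _ hbd.symm n4 n6]
    have hne : ∀ {x y}, B.T.graph.Adj x y → ¬ ((x = b ∧ y = d) ∨ (x = d ∧ y = b)) →
        A.T.graph.Adj x y := fun h h' => by
      rw [hg, flip_adj hq.ne] at h
      tauto
    by_cases h1 : (x = b ∧ y = d) ∨ (x = d ∧ y = b)
    · exact key hf h1
    have n1 := hp _ _ (hg ▸ hf.adj₁)
    have n2 := hp _ _ (hg ▸ hf.adj₂)
    have n3 := hp _ _ (hg ▸ hf.adj₃)
    by_cases h2 : (y = b ∧ z = d) ∨ (y = d ∧ z = b)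
    · rw [← triple_rotate, key hf.rotate h2, sgn_rotate _ _ _ n1 n2 n3]
    by_cases h3 : (z = b ∧ x = d) ∨ (z = d ∧ x = b)
    · rw [triple_rotate z, key hf.rotate.rotate h3, sgn_rotate _ _ _ n3 n1 n2]
    have hf' : IsOrientedFace A.T.graph x y z :=
      ⟨hf.cyc, hne hf.adj₁ h1, hne hf.adj₂ h2, hne hf.adj₃ h3⟩
    rw [hs₃ _ (Triangulation.isFace_of_isOrientedFace hf')
      (Triangulation.isFace_of_isOrientedFace hf), hA.sign hf']
  · rcases eq_of_four_ne _ _ _ _ n1 n2 n3 n4 hbd n6 k with h | h | h | h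
    exacts [⟨a, h.symm⟩, ⟨b, h.symm⟩, ⟨c, h.symm⟩, ⟨d, h.symm⟩]

theorem CompatibleWith.of_isFlip (hA : A.CompatibleWith col) (h : A.IsFlip B) :
    B.CompatibleWith col ∧ Function.Surjective col := by
  obtain ⟨a, b, c, d, habc, hacd, habd, hbcd, hbd, hac, hB, hs, hs₁, hs₂, hs₃⟩ := h
  rw [← faceSign_eq, ← faceSign_eq] at hs hs₁ hs₂
  have hs₃' : ∀ t, A.T.IsFace t → B.T.IsFace t → B.faceSign t = A.faceSign t := fun t h h' => by
    rw [faceSign_eq _ h, faceSign_eq _ h', hs₃]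
  obtain ⟨e1, e2, e3⟩ := habc.adj
  obtain ⟨e4, e5, e6⟩ := hacd.adj
  have n1 := e1.ne
  have n2 := e2.ne
  have n3 := e3.ne
  have n5 := e5.ne
  have n6 := e6.ne
  by_cases hc : Cyc a b c
  · refine hA.of_quad ⟨hc, ?_, e1, e2, e5, e6, e4⟩ hac hB hs hs₁ hs₂ hs₃'
    by_contra hc'
    exact hbd (A.T.isTri.face_unique hc (by grind [Cyc]) e1 e2 e6.symm e5.symm)
  -- The quadrilateral is listed against the boundary order; exchanging `a` and `c` reverses it.
  · have hc1 : Cyc c b a := by grind [Cyc]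
    have h1 : ({c, b, a} : Finset (Fin n)) = {a, b, c} := by
      rw [Finset.insert_comm, triple_rotate, Finset.pair_comm]
    refine hA.of_quad (a := c) (b := b) (c := a) (d := d)
      ⟨hc1, ?_, e2.symm, e1.symm, e6.symm, e5.symm, e3⟩
      (by rwa [Sym2.eq_swap]) (by rwa [Sym2.eq_swap (a := c)]) ?_ ?_ ?_ hs₃'
    · by_contra hc'
      exact hbd (A.T.isTri.face_unique hc1 (by grind [Cyc]) e2.symm e1.symm e5 e6)
    · rw [h1, Finset.insert_comm c a]
      exact hs
    · rw [h1, Finset.insert_comm c b]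
      exact hs₂
    · rw [h1, Finset.insert_comm b a]
      exact hs₁

theorem CompatibleWith.isFlip (hA : A.CompatibleWith col) (hB : B.CompatibleWith col)
    (h : Step col Finset.univ A.T.graph B.T.graph) : A.IsFlip B := by
  obtain ⟨-, -, a, b, c, d, hq, hbd, hg⟩ := h
  have n1 := hA.proper _ _ hq.adj₁
  have n2 := hA.proper _ _ hq.diag
  have n3 := (hA.proper _ _ hq.adj₄).symm
  have n4 := hA.proper _ _ hq.adj₂
  have n6 := hA.proper _ _ hq.adj₃
  obtain ⟨e0, e1, e2⟩ := sgn_quad _ _ _ _ n1 n2 n3 n4 hbd n6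
  have c1 := hq.cyc_left
  have c2 := hq.cyc_right
  have hq' := hq.flip
  rw [← hg] at hq'
  have f1 : IsOrientedFace A.T.graph a b c := ⟨c1, hq.adj₁, hq.adj₂, hq.diag.symm⟩
  have f2 : IsOrientedFace A.T.graph a c d := ⟨by grind [Cyc], hq.diag, hq.adj₃, hq.adj₄⟩
  have f3 : IsOrientedFace B.T.graph a b d := ⟨by grind [Cyc], hq'.adj₄, hq'.diag, hq'.adj₃⟩
  have f4 : IsOrientedFace B.T.graph b c d := ⟨by grind [Cyc], hq'.adj₁, hq'.adj₂, hq'.diag.symm⟩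
  have hcr : Cr a c b d := by grind [Cr, Cyc]
  refine ⟨a, b, c, d, Triangulation.isFace_of_isOrientedFace f1,
    Triangulation.isFace_of_isOrientedFace f2, Triangulation.isFace_of_isOrientedFace f3,
    Triangulation.isFace_of_isOrientedFace f4, hq.ne,
    A.T.mem_diagonals_iff.2 ⟨isDiagonal_of_cr hcr, hq.diag⟩, ?_, ?_, ?_, ?_, fun t h h' => ?_⟩
  · ext e
    induction e with
    | _ x y =>
      rw [Finset.mem_insert, Finset.mem_erase, Triangulation.mem_diagonals_iff,
        Triangulation.mem_diagonals_iff, hg, flip_adj hq.ne]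
      have h1 : s(x, y) = s(b, d) ↔ (x = b ∧ y = d) ∨ (x = d ∧ y = b) := Sym2.eq_iff
      have h2 : s(x, y) = s(a, c) ↔ (x = a ∧ y = c) ∨ (x = c ∧ y = a) := Sym2.eq_iff
      have h3 : s(x, y) = s(b, d) → IsDiagonal s(x, y) := fun h => h ▸ isDiagonal_of_cr hcr.comm
      grind
  · rw [← faceSign_eq, ← faceSign_eq, hA.sign f1, hA.sign f2, e0]
  · rw [← faceSign_eq, ← faceSign_eq, hA.sign f1, hB.sign f3, e1]
  · rw [← faceSign_eq, ← faceSign_eq, hA.sign f1, hB.sign f4, e2]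
  · rw [← faceSign_eq, ← faceSign_eq]
    obtain ⟨x, y, z, rfl, hf⟩ := h.exists_eq
    rw [hA.sign hf, hB.sign (h'.isOrientedFace hf.cyc)]

theorem CompatibleWith.of_reflTransGen (hA : A.CompatibleWith col)
    (h : Relation.ReflTransGen IsFlip A B) : B.CompatibleWith col := by
  induction h with
  | refl => exact hA
  | tail _ h ih => exact (ih.of_isFlip h).1

theorem CompatibleWith.reflTransGen_isFlip (hA : A.CompatibleWith col) (hB : B.CompatibleWith col)
    (h : Relation.ReflTransGen (Step col Finset.univ) A.T.graph B.T.graph) :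
    Relation.ReflTransGen IsFlip A B := by
  have key : ∀ {H}, Relation.ReflTransGen (Step col Finset.univ) A.T.graph H →
      ∃ C : TwoColouredTriangulation n, C.T.graph = H ∧ C.CompatibleWith col ∧
        Relation.ReflTransGen IsFlip A C := by
    intro H h
    induction h with
    | refl => exact ⟨A, rfl, hA, .refl⟩
    | tail _ h ih =>
      obtain ⟨C, rfl, hC, hAC⟩ := ih
      obtain ⟨D, rfl, hD⟩ := exists_compatibleWith_of_graph h.isTri h.proper
      exact ⟨D, rfl, hD, hAC.tail (hC.isFlip hD h)⟩
  obtain ⟨C, hC, hC', hAC⟩ := key h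
  -- The colouring determines the signs, so the lifted path ends at `B` itself.
  rwa [hC'.eq hB hC] at hAC

theorem exists_compatibleWith (hn : 2 ≤ n) (A : TwoColouredTriangulation n) :
    ∃ col, A.CompatibleWith col :=
  A.T.isTri.exists_compatible (by simpa)

theorem CompatibleWith.inducesColouring (h : A.CompatibleWith col) : A.InducesColouring col :=
  inducesColouring_iff.2 ⟨h.proper, h.locallyCompatible⟩

theorem exists_compatibleWith_of_compatible {ε : ℤˣ}
    (h : Compatible (fun t => ε * A.faceSign t) col A.T.graph) :
    ∃ B : TwoColouredTriangulation n, A ≈ B ∧ B.CompatibleWith col := by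
  rcases Int.units_eq_one_or ε with rfl | rfl
  · simp only [one_mul] at h
    exact ⟨A, .inl rfl, h⟩
  · refine ⟨A.neg, .inr rfl, h.proper, fun hf => ?_⟩
    rw [← h.sign hf, faceSign_neg A (Triangulation.isFace_of_isOrientedFace hf), neg_one_mul]

end TwoColouredTriangulation

/-! ### Passage to classes and conclusion -/

namespace SignedTriangulation

open TwoColouredTriangulation

/-- Both ambiguities are signs: a permutation of the colours multiplies all orientations by its
parity, and the other sign comes from the local condition. Together they are absorbed by the choice
of representative. -/
theorem induces_iff (hn : 3 ≤ n) {X : SignedTriangulation n} {col : Fin n → Fin 4} :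
    X.Induces (Quotient.mk _ col) ↔
      ∃ A : TwoColouredTriangulation n, X = Quotient.mk _ A ∧ A.CompatibleWith col := by
  constructor
  · rintro ⟨A, col', rfl, hcol, hA⟩
    obtain ⟨σ, rfl⟩ := Quotient.exact hcol.symm
    rw [inducesColouring_iff] at hA
    obtain ⟨ε, h⟩ := A.T.isTri.compatible_of_locallyCompatible (by simpa) hA.1 hA.2
    obtain ⟨δ, hδ⟩ := sgn_perm σ
    have h' := h.perm hδ
    simp only [← mul_assoc] at h'
    obtain ⟨B, hAB, hB⟩ := exists_compatibleWith_of_compatible h'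
    exact ⟨B, Quotient.sound hAB, hB⟩
  · rintro ⟨A, rfl, hA⟩
    exact ⟨A, col, rfl, rfl, hA.inducesColouring⟩

theorem exists_induces (hn : 3 ≤ n) (X : SignedTriangulation n) :
    ∃ κ : VertexColouring n, X.Induces κ := by
  induction X using Quotient.inductionOn with
  | h A =>
    obtain ⟨col, hA⟩ := A.exists_compatibleWith (by omega)
    exact ⟨_, (induces_iff hn).2 ⟨A, rfl, hA⟩⟩

theorem Induces.eq (hn : 3 ≤ n) {X : SignedTriangulation n} {κ κ' : VertexColouring n}
    (h : X.Induces κ) (h' : X.Induces κ') : κ = κ' := by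
  induction κ using Quotient.inductionOn with
  | h col =>
  induction κ' using Quotient.inductionOn with
  | h col' =>
  obtain ⟨A, rfl, hA⟩ := (induces_iff hn).1 h
  obtain ⟨B, hAB, hB⟩ := (induces_iff hn).1 h'
  have key : ∀ {col'}, A.CompatibleWith col' →
      (Quotient.mk _ col : VertexColouring n) = Quotient.mk _ col' := fun h' => by
    obtain ⟨σ, hσ, -⟩ := A.T.isTri.exists_perm_of_compatible (by simp; omega) hA h'
    exact Quotient.sound ⟨σ, funext fun x => hσ x (Finset.mem_univ _)⟩
  rcases Quotient.exact hAB with rfl | rfl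
  · exact key hB
  -- A transposition of colours undoes the global sign change.
  · have h1 : Compatible (fun t => -1 * A.neg.faceSign t)
        (Equiv.swap (0 : Fin 4) 1 ∘ col') A.T.graph :=
      Compatible.perm hB fun a b c h1 h2 h3 => by
        rw [sgn_swap 0 1 (by decide) a b c h1 h2 h3, neg_one_mul]
    refine (key ⟨h1.proper, fun hf => ?_⟩).trans (Quotient.sound (Setoid.symm ⟨_, rfl⟩))
    rw [← h1.sign hf, faceSign_neg A (Triangulation.isFace_of_isOrientedFace hf), neg_one_mul,
      _root_.neg_neg]

theorem Linked.exists_induces (hn : 3 ≤ n) {X Y : SignedTriangulation n} (h : X.Linked Y)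
    (hXY : X ≠ Y) :
    ∃ κ : VertexColouring n, X.Induces κ ∧ Y.Induces κ ∧ κ.UsesFourColours := by
  obtain ⟨A, B, rfl, rfl, hAB⟩ := h
  obtain ⟨col, hA⟩ := A.exists_compatibleWith (by omega)
  refine ⟨Quotient.mk _ col, (induces_iff hn).2 ⟨A, rfl, hA⟩,
    (induces_iff hn).2 ⟨B, rfl, hA.of_reflTransGen hAB⟩, col, rfl, ?_⟩
  -- Distinct classes need at least one flip, and its quadrilateral already shows all four colours.
  rcases hAB.cases_head with rfl | ⟨C, hC, -⟩
  · exact (hXY rfl).elim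
  · exact (hA.of_isFlip hC).2

theorem Induces.linked (hn : 3 ≤ n) {X Y : SignedTriangulation n} {κ : VertexColouring n}
    (hX : X.Induces κ) (hY : Y.Induces κ) (hκ : κ.UsesFourColours) : X.Linked Y := by
  obtain ⟨col, rfl, hcol⟩ := hκ
  obtain ⟨A, rfl, hA⟩ := (induces_iff hn).1 hX
  obtain ⟨B, rfl, hB⟩ := (induces_iff hn).1 hY
  refine ⟨A, B, rfl, rfl, hA.reflTransGen_isFlip hB ?_⟩
  exact conn_of_surjective A.T.isTri B.T.isTri hA.proper hB.proper fun k => by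
    obtain ⟨x, hx⟩ := hcol k
    exact ⟨x, Finset.mem_univ _, hx⟩

end SignedTriangulation

end PolygonFlip

theorem theoremA1 (n : ℕ) (hn : 3 ≤ n) :
    (∀ X : PolygonFlip.SignedTriangulation n,
      ∃! κ : PolygonFlip.VertexColouring n, X.Induces κ) ∧
    ∀ X Y : PolygonFlip.SignedTriangulation n, X ≠ Y →
      (X.Linked Y ↔
        ∃ κ : PolygonFlip.VertexColouring n,
          X.Induces κ ∧ Y.Induces κ ∧ κ.UsesFourColours) := by
  refine ⟨fun X => ?_, fun X Y hXY => ⟨fun h => h.exists_induces hn hXY, ?_⟩⟩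
  · obtain ⟨κ, hκ⟩ := X.exists_induces hn
    exact ⟨κ, hκ, fun κ' hκ' => hκ'.eq hn hκ⟩
  · rintro ⟨κ, hX, hY, hκ⟩
    exact hX.linked hn hY hκ
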